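/- Let $S\in\{\tfrac12,1,\tfrac32,\dots\}$ and let $S^1,S^2,S^3$ be the spin-$S$ operators on $\mathbb{C}^{2S+1}$, i.e. the generators of the $(2S+1)$-dimensional irreducible representation of $SU(2)$. For $L\ge 1$ let $$H_L=\sum_{x=1}^{L-1}\bigl(S^2-\vec S_x\cdot\vec S_{x+1}\bigr)$$ be the ferromagnetic Heisenberg Hamiltonian on $\bigotimes_{x=1}^L\mathbb{C}^{2S+1}$, where $\vec S_x=(S^1_x,S^2_x,S^3_x)$ denotes the spin operators acting on the $x$-th factor. For $\beta>0$ let $$f_L(\beta,S)=-\frac1{\beta L}\ln\operatorname{Tr}e^{-\beta H_L},\qquad f(\beta,S)=\lim_{L\to\infty}f_L(\beta,S),\qquad C_1=\frac1{2\pi}\int_{\mathbb R}\ln\bigl(1-e^{-p^2}\bigr)\,dp<0 .$$ The limit defining $f(\beta,S)$ exists for all $\beta>0$ and all such $S$, and, as $\beta S\to\infty$, $$f(\beta,S)\le C_1S^{-1/2}\beta^{-3/2}\Bigl(1-\mathcal O\bigl((\beta S)^{-1/8}(\ln\beta S)^{3/4}\bigr)\Bigr)$$ uniformly in $S$ and $\beta$.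 That is, there are absolute constants $C>0$ and $X_0>1$ such that for all $S\in\{\tfrac12,1,\tfrac32,\dots\}$ and all $\beta>0$ with $\beta S\ge X_0$, $$f(\beta,S)\le C_1S^{-1/2}\beta^{-3/2}\Bigl(1-C(\beta S)^{-1/8}(\ln\beta S)^{3/4}\Bigr).$$ -/

import Mathlib

open Filter Topology

noncomputable section

namespace Heisenberg

/-- The spin `S = N / 2`, where `N = 2S` is a natural number. -/
def spin (N : ℕ) : ℝ := (N : ℝ) / 2

/-- The raising operator `S⁺` of the spin `S = N / 2` representation on `ℂ ^ (2S + 1)`. The basis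
vector with index `n = 0, …, 2S` is the eigenvector of `S³` with eigenvalue `n - S`, and
`S⁺ |n⟩ = √((n + 1) (2S - n)) |n + 1⟩`. -/
def spinPlus (N : ℕ) : Matrix (Fin (N + 1)) (Fin (N + 1)) ℂ :=
  fun i j => if (i : ℕ) = (j : ℕ) + 1 then
    ((Real.sqrt (((j : ℝ) + 1) * ((N : ℝ) - (j : ℝ))) : ℝ) : ℂ) else 0

/-- The lowering operator `S⁻ = (S⁺)*`. -/
def spinMinus (N : ℕ) : Matrix (Fin (N + 1)) (Fin (N + 1)) ℂ :=
  (spinPlus N).conjTranspose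

/-- The spin component `S¹ = (S⁺ + S⁻) / 2`. -/
def spin1 (N : ℕ) : Matrix (Fin (N + 1)) (Fin (N + 1)) ℂ :=
  (1 / 2 : ℂ) • (spinPlus N + spinMinus N)

/-- The spin component `S² = (S⁺ - S⁻) / (2i)`. -/
def spin2 (N : ℕ) : Matrix (Fin (N + 1)) (Fin (N + 1)) ℂ :=
  (1 / (2 * Complex.I) : ℂ) • (spinPlus N - spinMinus N)

/-- The spin component `S³`, diagonal with eigenvalues `-S, -S + 1, …, S`. -/
def spin3 (N : ℕ) : Matrix (Fin (N + 1)) (Fin (N + 1)) ℂ :=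
  Matrix.diagonal fun n => (((n : ℝ) - spin N : ℝ) : ℂ)

/-- The product basis of the Hilbert space `⨂_{x = 1}^L ℂ ^ (2S + 1)` of a chain of `L` sites:
one index in `{0, …, 2S}` for every site. -/
abbrev Config (N L : ℕ) : Type := Fin L → Fin (N + 1)

/-- The operator on the chain that acts as `A` on the site `x` and as the identity on all other
sites, i.e. `1 ⊗ ⋯ ⊗ 1 ⊗ A ⊗ 1 ⊗ ⋯ ⊗ 1`, as a matrix in the product basis. -/
def siteOp {N L : ℕ} (x : Fin L) (A : Matrix (Fin (N + 1)) (Fin (N + 1)) ℂ) :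
    Matrix (Config N L) (Config N L) ℂ :=
  fun σ τ => if ∀ y, y ≠ x → σ y = τ y then A (σ x) (τ x) else 0

/-- The scalar product `S_x · S_y` of the spin operators on the sites `x` and `y`. -/
def spinDot (N : ℕ) {L : ℕ} (x y : Fin L) : Matrix (Config N L) (Config N L) ℂ :=
  siteOp x (spin1 N) * siteOp y (spin1 N) + siteOp x (spin2 N) * siteOp y (spin2 N)
    + siteOp x (spin3 N) * siteOp y (spin3 N)

/-- The Heisenberg Hamiltonian `H_L = ∑_{x = 1}^{L - 1} (S² - S_x · S_{x + 1})` of a chain of `L`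
sites; the sum is over the pairs `(x, y)` of sites with `y = x + 1`. -/
def hamiltonian (N L : ℕ) : Matrix (Config N L) (Config N L) ℂ :=
  ∑ x : Fin L, ∑ y : Fin L, if (x : ℕ) + 1 = (y : ℕ) then
    (((spin N) ^ 2 : ℝ) : ℂ) • (1 : Matrix (Config N L) (Config N L) ℂ) - spinDot N x y else 0

/-- The partition function `Tr exp (-β H_L)`. The Hamiltonian is Hermitian, so this trace is a
positive real number. -/
def partitionFunction (N L : ℕ) (β : ℝ) : ℝ :=
  (Matrix.trace (NormedSpace.exp (-(β : ℂ) • hamiltonian N L))).re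

/-- The specific free energy `f_L(β, S) = -(1 / (β L)) ln Tr exp (-β H_L)` for `S = N / 2`. -/
def finiteFreeEnergy (N L : ℕ) (β : ℝ) : ℝ :=
  -(1 / (β * (L : ℝ))) * Real.log (partitionFunction N L β)

/-- The specific free energy in the thermodynamic limit, `f(β, S) = lim_{L → ∞} f_L(β, S)` for
`S = N / 2`. -/
def freeEnergy (N : ℕ) (β : ℝ) : ℝ :=
  limUnder atTop fun L : ℕ => finiteFreeEnergy N L β

/-- The constant `C₁ = (1 / (2π)) ∫_ℝ ln (1 - exp (-p²)) dp`. -/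
def C₁ : ℝ := 1 / (2 * Real.pi) * ∫ p : ℝ, Real.log (1 - Real.exp (-p ^ 2))

end Heisenberg

end

/-! An upper bound on the free energy is a lower bound on a partition function, so trial states
suffice. At low temperature the chain behaves like free bosons (spin waves) with energies `4 S sin²
(k / 2) ≈ S k²`, and `C₁` is the free energy constant of that gas. The proof makes this comparison
on blocks of finite length and then optimizes the length.

Localization. In the Holstein–Primakoff form each bond is `½ D* D` (`bondOp_eq`), hence nonnegative
and bounded by one-site potentials that vanish on the vacuum (`quadForm_bondOp_le`). Putting these
potentials at the two ends makes the logarithm of the partition function superadditive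
(`dirichletPartition_mul_le`). Fekete's lemma gives the limit, and it is bounded by the value on any
single block (`freeEnergy_le`).

Trial states. Polynomials with the Fischer inner product are the Fock space, and `spinVec` maps them
to the spin space. This map is a contraction, so it sends orthonormal families to Bessel families
(`isBessel_spinVec`), which is all that `le_gibbsTrace` asks for. It turns the root of a bond into a
difference of derivatives times a factor whose square is at most `2S` (`bondRoot_spinVec`), so the
energy is at most that of free bosons. The norm that is lost is at most the sum of the squared
particle densities (`le_normSq_fockState`).

Evaluation. The modes are sines vanishing at both ends, where the boundary potential then costs
nothing. Let the block have `t` thermal wave lengths, `β S t² = n²`. By Markov's inequality half of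
the free partition function comes from states with at most `2 t²` particles and `β` times the energy
at most `8 t`; the missing norm then costs `256 t⁵ / n` in the logarithm, and replacing the sum over
modes by an integral costs about `2 log t` (`le_log_dirichletPartition`). With `R = (β S) ^ (1 / 8)`
and `w = (log (β S)) ^ (1 / 4)`, the choice `n ≈ R⁵ w`, `t ≈ R w` makes both errors of order `w⁴`,
and the relative error is `w⁴ / t ≈ w³ / R` (`freeEnergy_le_of_large`). -/

noncomputable section

namespace Heisenberg

open Matrix

/-! ### Bessel families and the variational principle for the partition function. -/

section Bessel

variable {n : Type*} [Fintype n]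

/-- The real part of the quadratic form of a matrix. -/
def quadForm (A : Matrix n n ℂ) (v : n → ℂ) : ℝ := (star v ⬝ᵥ A *ᵥ v).re

/-- The squared `ℓ²` norm of a vector. -/
def normSq (v : n → ℂ) : ℝ := ∑ i, ‖v i‖ ^ 2

/-- A family of vectors satisfying Bessel's inequality. -/
def IsBessel {ι : Type*} (F : Finset ι) (v : ι → n → ℂ) : Prop :=
  ∀ ψ : n → ℂ, ∑ m ∈ F, ‖star ψ ⬝ᵥ v m‖ ^ 2 ≤ normSq ψ

lemma isBessel_of_orthonormal {ι : Type*} (F : Finset ι) {v : ι → n → ℂ}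
    (hv : Orthonormal ℂ fun m => (WithLp.toLp 2 (v m) : EuclideanSpace ℂ n)) :
    IsBessel F v := by
  intro ψ
  have h := hv.sum_inner_products_le (x := WithLp.toLp 2 ψ) (s := F)
  rw [EuclideanSpace.norm_sq_eq] at h
  refine le_trans (le_of_eq ?_) h
  refine Finset.sum_congr rfl fun m _ => ?_
  rw [← inner_conj_symm, RCLike.norm_conj, EuclideanSpace.inner_eq_star_dotProduct, 
    dotProduct_comm]

end Bessel

section Variational

variable {n : Type*} [Fintype n] [DecidableEq n]

/-- The coefficients of a vector in the eigenbasis of a Hermitian matrix. -/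
def eigenCoeff {A : Matrix n n ℂ} (hA : A.IsHermitian) (v : n → ℂ) (i : n) : ℂ :=
  star (⇑(hA.eigenvectorBasis i)) ⬝ᵥ v

lemma eigenCoeff_eq_inner {A : Matrix n n ℂ} (hA : A.IsHermitian) (v : n → ℂ) (i : n) :
    eigenCoeff hA v i = inner ℂ (hA.eigenvectorBasis i) (WithLp.toLp 2 v) := by
  rw [EuclideanSpace.inner_eq_star_dotProduct, dotProduct_comm]
  rfl

lemma normSq_eigenvector {A : Matrix n n ℂ} (hA : A.IsHermitian) (i : n) :
    normSq (⇑(hA.eigenvectorBasis i)) = 1 := by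
  have h := hA.eigenvectorBasis.orthonormal.1 i
  rw [normSq, ← EuclideanSpace.norm_sq_eq, h, one_pow]

lemma sum_eigenCoeff_sq {A : Matrix n n ℂ} (hA : A.IsHermitian) (v : n → ℂ) :
    ∑ i, ‖eigenCoeff hA v i‖ ^ 2 = normSq v := by
  simp_rw [eigenCoeff_eq_inner]
  rw [hA.eigenvectorBasis.sum_sq_norm_inner_right, EuclideanSpace.norm_sq_eq]
  rfl

lemma eigenCoeff_mulVec {A : Matrix n n ℂ} (hA : A.IsHermitian) (v : n → ℂ) (i : n) :
    eigenCoeff hA (A *ᵥ v) i = hA.eigenvalues i * eigenCoeff hA v i := by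
  have h := hA.mulVec_eigenvectorBasis i
  rw [eigenCoeff, dotProduct_mulVec]
  have h2 : star (⇑(hA.eigenvectorBasis i)) ᵥ* A
      = (hA.eigenvalues i : ℂ) • star (⇑(hA.eigenvectorBasis i)) := by
    have h3 := congrArg star h
    rw [star_mulVec, hA.eq] at h3
    rw [h3]
    ext j
    simp
  rw [h2, smul_dotProduct, smul_eq_mul]
  rfl

lemma quadForm_eq_sum {A : Matrix n n ℂ} (hA : A.IsHermitian) (v : n → ℂ) :
    quadForm A v = ∑ i, hA.eigenvalues i * ‖eigenCoeff hA v i‖ ^ 2 := by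
  have h1 : star v ⬝ᵥ A *ᵥ v = inner ℂ (WithLp.toLp 2 v) (WithLp.toLp 2 (A *ᵥ v)) := by
    rw [EuclideanSpace.inner_eq_star_dotProduct, dotProduct_comm]
  rw [quadForm, h1, ← hA.eigenvectorBasis.sum_inner_mul_inner, Complex.re_sum]
  refine Finset.sum_congr rfl fun i _ => ?_
  rw [← eigenCoeff_eq_inner, eigenCoeff_mulVec, ← inner_conj_symm, ← eigenCoeff_eq_inner]
  rw [show ∀ a b : ℂ, (starRingEnd ℂ) b * (a * b) = a * ((starRingEnd ℂ) b * b) by intros; ring,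
    Complex.conj_mul', ← Complex.ofReal_pow, ← Complex.ofReal_mul, Complex.ofReal_re]

lemma quadForm_eigenvector {A : Matrix n n ℂ} (hA : A.IsHermitian) (i : n) :
    quadForm A (⇑(hA.eigenvectorBasis i)) = hA.eigenvalues i := by
  rw [hA.eigenvalues_eq]
  rfl

/-- The trace of `exp (-β A)`, the partition function of the Hamiltonian `A`. -/
def gibbsTrace (β : ℝ) (A : Matrix n n ℂ) : ℝ :=
  (Matrix.trace (NormedSpace.exp (-(β : ℂ) • A))).re

lemma gibbsTrace_eq_sum {A : Matrix n n ℂ} (hA : A.IsHermitian) (β : ℝ) :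
    gibbsTrace β A = ∑ i, Real.exp (-β * hA.eigenvalues i) := by
  set U : Matrix n n ℂ := (hA.eigenvectorUnitary).1 with hU
  have hUU : U * star U = 1 := Unitary.coe_mul_star_self hA.eigenvectorUnitary
  have hUi : U⁻¹ = star U := Matrix.inv_eq_right_inv hUU
  have hUu : IsUnit U := IsUnit.of_mul_eq_one _ hUU
  have hs : -(β : ℂ) • A = U * diagonal (fun i => -(β : ℂ) * hA.eigenvalues i) * U⁻¹ := by
    have h := hA.spectral_theorem
    rw [Unitary.conjStarAlgAut_apply] at h
    rw [hUi]
    have hd : diagonal (fun i => -(β : ℂ) * (hA.eigenvalues i : ℂ))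
        = -(β : ℂ) • diagonal (RCLike.ofReal ∘ hA.eigenvalues) := by
      rw [← diagonal_smul]; rfl
    rw [hd, Matrix.mul_smul, Matrix.smul_mul]
    conv_lhs => rw [h]
  rw [gibbsTrace, hs, Matrix.exp_conj _ _ hUu, Matrix.trace_mul_cycle,
    Matrix.nonsing_inv_mul _ ((Matrix.isUnit_iff_isUnit_det _).1 hUu), Matrix.one_mul,
    Matrix.exp_diagonal, Matrix.trace_diagonal, Complex.re_sum]
  refine Finset.sum_congr rfl fun i _ => ?_
  rw [Pi.coe_exp, ← Complex.exp_eq_exp_ℂ, ← Complex.exp_ofReal_re]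
  push_cast
  rfl

lemma gibbsTrace_pos [Nonempty n] {A : Matrix n n ℂ} (hA : A.IsHermitian) (β : ℝ) :
    0 < gibbsTrace β A := by
  rw [gibbsTrace_eq_sum hA]
  exact Finset.sum_pos (fun i _ => Real.exp_pos _) Finset.univ_nonempty

/-- A variational lower bound on the partition function. -/
lemma le_gibbsTrace {ι : Type*} {A : Matrix n n ℂ} (hA : A.IsHermitian) (β : ℝ)
    {F : Finset ι} {v : ι → n → ℂ} (hv : IsBessel F v) (r : ι → ℝ) :
    ∑ m ∈ F, Real.exp (-r m) * ((1 + r m) * normSq (v m) - β * quadForm A (v m))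
      ≤ gibbsTrace β A := by
  rw [gibbsTrace_eq_sum hA]
  calc _ ≤ ∑ m ∈ F, ∑ i, Real.exp (-β * hA.eigenvalues i) * ‖eigenCoeff hA (v m) i‖ ^ 2 := by
        refine Finset.sum_le_sum fun m _ => ?_
        rw [← sum_eigenCoeff_sq hA, quadForm_eq_sum hA, Finset.mul_sum, Finset.mul_sum,
          ← Finset.sum_sub_distrib, Finset.mul_sum]
        refine Finset.sum_le_sum fun i _ => ?_
        -- The graph of `exp (-y)` lies above its tangent line at `y = r m`. Because the bound is
        -- linear in the eigenvalue, it sums to the quadratic form of `A`.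
        have h1 : Real.exp (-r m) * (1 + r m - β * hA.eigenvalues i)
            ≤ Real.exp (-β * hA.eigenvalues i) := by
          have h2 := Real.add_one_le_exp (r m - β * hA.eigenvalues i)
          calc _ ≤ Real.exp (-r m) * Real.exp (r m - β * hA.eigenvalues i) := by
                gcongr; linarith
            _ = _ := by rw [← Real.exp_add]; ring_nf
        calc _ = (Real.exp (-r m) * (1 + r m - β * hA.eigenvalues i))
              * ‖eigenCoeff hA (v m) i‖ ^ 2 := by ring
          _ ≤ _ := by gcongr
    _ = ∑ i, Real.exp (-β * hA.eigenvalues i) * ∑ m ∈ F, ‖eigenCoeff hA (v m) i‖ ^ 2 := by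
        rw [Finset.sum_comm]; simp_rw [Finset.mul_sum]
    _ ≤ ∑ i, Real.exp (-β * hA.eigenvalues i) * 1 := by
        gcongr with i
        rw [← normSq_eigenvector hA i]
        exact hv _
    _ = _ := by simp

/-- Peierls–Bogoliubov monotonicity: if the quadratic form of `A` on an eigenbasis of `B` is at
most that of `B` plus a constant. -/
lemma gibbsTrace_le_exp_mul {A B : Matrix n n ℂ} (hA : A.IsHermitian) (hB : B.IsHermitian) {β : ℝ}
    (hβ : 0 ≤ β) (c : ℝ) (h : ∀ v, quadForm A v ≤ quadForm B v + c * normSq v) :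
    Real.exp (-(β * c)) * gibbsTrace β B ≤ gibbsTrace β A := by
  have hb : IsBessel Finset.univ fun i => (⇑(hB.eigenvectorBasis i) : n → ℂ) :=
    isBessel_of_orthonormal _ hB.eigenvectorBasis.orthonormal
  refine le_trans ?_ (le_gibbsTrace hA β hb fun i => β * (hB.eigenvalues i + c))
  rw [gibbsTrace_eq_sum hB, Finset.mul_sum]
  refine Finset.sum_le_sum fun i _ => ?_
  have h1 := h (⇑(hB.eigenvectorBasis i))
  rw [normSq_eigenvector, quadForm_eigenvector] at h1
  rw [normSq_eigenvector, ← Real.exp_add]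
  have h2 := mul_le_mul_of_nonneg_left h1 hβ
  calc _ = Real.exp (-(β * (hB.eigenvalues i + c))) * 1 := by ring_nf
    _ ≤ _ := by gcongr; linarith

end Variational

end Heisenberg

namespace Heisenberg

open Matrix

/-! ### Algebra of one-site operators on the chain. -/

section SiteOperators

variable {N L : ℕ}

lemma siteOp_mulVec (x : Fin L) (A : Matrix (Fin (N + 1)) (Fin (N + 1)) ℂ) (v : Config N L → ℂ)
    (σ : Config N L) :
    (siteOp x A *ᵥ v) σ = ∑ k, A (σ x) k * v (Function.update σ x k) := by
  rw [mulVec, dotProduct]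
  symm
  refine Fintype.sum_of_injective (fun k => Function.update σ x k)
    (Function.update_injective σ x) _ _ ?_ ?_
  · intro τ hτ
    rw [siteOp, if_neg, zero_mul]
    intro h
    refine hτ ⟨τ x, ?_⟩
    ext y
    by_cases hy : y = x
    · subst hy; simp
    · simp [hy, h y hy]
  · intro k
    rw [siteOp, if_pos, Function.update_self]
    intro y hy
    rw [Function.update_of_ne hy]

lemma siteOp_add (x : Fin L) (A B : Matrix (Fin (N + 1)) (Fin (N + 1)) ℂ) :
    siteOp x (A + B) = siteOp x A + siteOp x B := by
  ext σ τ
  simp only [siteOp, Matrix.add_apply]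
  split_ifs <;> simp

lemma siteOp_smul (x : Fin L) (c : ℂ) (A : Matrix (Fin (N + 1)) (Fin (N + 1)) ℂ) :
    siteOp x (c • A) = c • siteOp x A := by
  ext σ τ
  simp only [siteOp, Matrix.smul_apply]
  split_ifs <;> simp

lemma siteOp_sub (x : Fin L) (A B : Matrix (Fin (N + 1)) (Fin (N + 1)) ℂ) :
    siteOp x (A - B) = siteOp x A - siteOp x B := by
  ext σ τ
  simp only [siteOp, Matrix.sub_apply]
  split_ifs <;> simp

lemma siteOp_diagonal (x : Fin L) (d : Fin (N + 1) → ℂ) :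
    siteOp x (diagonal d) = diagonal fun σ : Config N L => d (σ x) := by
  ext σ τ
  by_cases h : σ = τ
  · subst h; simp [siteOp]
  · rw [diagonal_apply_ne _ h, siteOp]
    split_ifs with h1
    · rw [diagonal_apply_ne]
      intro h2
      refine h (funext fun y => ?_)
      by_cases hy : y = x
      · rw [hy, h2]
      · exact h1 y hy
    · rfl

lemma siteOp_one (x : Fin L) : siteOp x (1 : Matrix (Fin (N + 1)) (Fin (N + 1)) ℂ) = 1 := by
  rw [← diagonal_one, siteOp_diagonal, diagonal_one]

lemma siteOp_conjTranspose (x : Fin L) (A : Matrix (Fin (N + 1)) (Fin (N + 1)) ℂ) :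
    (siteOp x A)ᴴ = siteOp x Aᴴ := by
  ext σ τ
  simp only [siteOp, conjTranspose_apply]
  by_cases h : ∀ y, y ≠ x → σ y = τ y
  · rw [if_pos h, if_pos fun y hy => (h y hy).symm]
  · rw [if_neg h, if_neg fun h' => h fun y hy => (h' y hy).symm, star_zero]

lemma siteOp_mul (x : Fin L) (A B : Matrix (Fin (N + 1)) (Fin (N + 1)) ℂ) :
    siteOp x A * siteOp x B = siteOp x (A * B) := by
  refine Matrix.ext_of_mulVec_single fun τ => ?_
  generalize (Pi.single τ 1 : Config N L → ℂ) = v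
  ext σ
  rw [← mulVec_mulVec, siteOp_mulVec, siteOp_mulVec]
  simp_rw [siteOp_mulVec, Function.update_self, Function.update_idem, mul_apply, Finset.mul_sum,
    Finset.sum_mul]
  rw [Finset.sum_comm]
  simp_rw [mul_assoc]

lemma siteOp_comm {x y : Fin L} (h : x ≠ y) (A B : Matrix (Fin (N + 1)) (Fin (N + 1)) ℂ) :
    siteOp x A * siteOp y B = siteOp y B * siteOp x A := by
  refine Matrix.ext_of_mulVec_single fun τ => ?_
  generalize (Pi.single τ 1 : Config N L → ℂ) = v
  ext σ
  rw [← mulVec_mulVec, ← mulVec_mulVec, siteOp_mulVec, siteOp_mulVec]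
  simp_rw [siteOp_mulVec, Function.update_of_ne h, Function.update_of_ne h.symm, Finset.mul_sum]
  rw [Finset.sum_comm]
  refine Finset.sum_congr rfl fun l _ => Finset.sum_congr rfl fun k _ => ?_
  rw [Function.update_comm h]
  ring

lemma siteOp_mul_mul {x y : Fin L} (h : x ≠ y) (A B C D : Matrix (Fin (N + 1)) (Fin (N + 1)) ℂ) :
    (siteOp x A * siteOp y B) * (siteOp x C * siteOp y D)
      = siteOp x (A * C) * siteOp y (B * D) := by
  rw [← siteOp_mul, ← siteOp_mul, mul_assoc, ← mul_assoc (siteOp y B), siteOp_comm h.symm B C]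
  simp only [mul_assoc]

lemma siteOp_mul_conjTranspose {x y : Fin L} (h : x ≠ y)
    (A B : Matrix (Fin (N + 1)) (Fin (N + 1)) ℂ) :
    (siteOp x A * siteOp y B)ᴴ = siteOp x Aᴴ * siteOp y Bᴴ := by
  rw [conjTranspose_mul, siteOp_conjTranspose, siteOp_conjTranspose, siteOp_comm h]

end SiteOperators

/-! ### The Holstein–Primakoff representation. -/

section HolsteinPrimakoff

variable (N : ℕ)

/-- The truncated boson annihilation operator. -/
def annih : Matrix (Fin (N + 1)) (Fin (N + 1)) ℂ :=
  fun i j => if (j : ℕ) = (i : ℕ) + 1 then ((Real.sqrt ((i : ℝ) + 1) : ℝ) : ℂ) else 0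

/-- The diagonal operator `√(2S - n)`. -/
def hole : Matrix (Fin (N + 1)) (Fin (N + 1)) ℂ :=
  diagonal fun i => ((Real.sqrt ((N : ℝ) - (i : ℝ)) : ℝ) : ℂ)

/-- The number operator. -/
def num : Matrix (Fin (N + 1)) (Fin (N + 1)) ℂ := diagonal fun i => ((i : ℕ) : ℂ)

lemma cast_le_of_fin {N : ℕ} (i : Fin (N + 1)) : ((i : ℕ) : ℝ) ≤ N := by
  exact_mod_cast Nat.lt_succ_iff.1 i.2

/-- Bosons are counted upwards from the lowest weight vector, so lowering the spin annihilates a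
boson. -/
lemma spinMinus_eq : spinMinus N = hole N * annih N := by
  ext i j
  rw [hole, diagonal_mul, spinMinus, conjTranspose_apply, spinPlus, annih]
  split_ifs with h
  · have hi := cast_le_of_fin i
    rw [mul_comm, Real.sqrt_mul (by linarith), mul_comm]
    simp [mul_comm]
  · simp

lemma hole_conjTranspose : (hole N)ᴴ = hole N := by
  rw [hole, diagonal_conjTranspose]
  congr 1
  ext i
  simp

lemma spinPlus_eq : spinPlus N = (annih N)ᴴ * hole N := by
  have h := congrArg conjTranspose (spinMinus_eq N)
  rwa [spinMinus, conjTranspose_conjTranspose, conjTranspose_mul, hole_conjTranspose] at h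

lemma annih_conjTranspose_mul : (annih N)ᴴ * annih N = num N := by
  ext i j
  rw [mul_apply, num]
  simp only [conjTranspose_apply, annih]
  by_cases h : i = j
  · subst h
    rw [diagonal_apply_eq]
    by_cases hi : (i : ℕ) = 0
    · rw [Finset.sum_eq_zero, hi, Nat.cast_zero]
      intro k _
      rw [if_neg (by omega)]; simp
    · have hlt : (i : ℕ) - 1 < N + 1 := by omega
      rw [Finset.sum_eq_single (⟨(i : ℕ) - 1, hlt⟩ : Fin (N + 1))]
      · have h1 : (i : ℕ) = (i : ℕ) - 1 + 1 := by omega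
        rw [if_pos h1]
        have h2 : (((i : ℕ) - 1 : ℕ) : ℝ) + 1 = (i : ℕ) := by
          exact_mod_cast h1.symm
        simp only [h2]
        rw [Complex.star_def, Complex.conj_ofReal, ← Complex.ofReal_mul,
          Real.mul_self_sqrt (Nat.cast_nonneg _)]
        simp
      · intro k _ hk
        rw [if_neg]
        · simp
        · intro h; apply hk; ext; simp; omega
      · simp
  · rw [diagonal_apply_ne _ h]
    refine Finset.sum_eq_zero fun k _ => ?_
    by_cases h1 : (i : ℕ) = k + 1
    · rw [if_neg (show ¬ (j : ℕ) = k + 1 from fun h2 => h (Fin.ext (by omega))), mul_zero]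
    · rw [if_neg h1]; simp

lemma hole_mul_hole : hole N * hole N = (N : ℂ) • 1 - num N := by
  rw [hole, diagonal_mul_diagonal, num, ← diagonal_one, ← diagonal_smul, diagonal_sub]
  congr 1
  ext i
  have hi := cast_le_of_fin i
  rw [← Complex.ofReal_mul, Real.mul_self_sqrt (by linarith)]
  simp

lemma spin3_eq : spin3 N = num N - ((N : ℂ) / 2) • 1 := by
  rw [spin3, num, ← diagonal_one, ← diagonal_smul, diagonal_sub]
  congr 1
  ext i
  simp [spin]

variable {L : ℕ}

/-- The interaction `S² - S_x · S_y` of two sites. -/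
def bondOp (x y : Fin L) : Matrix (Config N L) (Config N L) ℂ :=
  (((spin N) ^ 2 : ℝ) : ℂ) • (1 : Matrix (Config N L) (Config N L) ℂ) - spinDot N x y

/-- The square root of the interaction in the Holstein–Primakoff representation. -/
def bondRoot (x y : Fin L) : Matrix (Config N L) (Config N L) ℂ :=
  siteOp x (annih N) * siteOp y (hole N) - siteOp x (hole N) * siteOp y (annih N)

/-- In `D* D` the cross terms are the exchange terms `S⁺ S⁻`, and the diagonal terms give `n_x (2S -
n_y) + (2S - n_x) n_y = 2 (S² - S³_x S³_y)`. The form as a square gives positivity, and later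
exposes a discrete gradient. -/
lemma bondOp_eq {x y : Fin L} (h : x ≠ y) :
    bondOp N x y = (1 / 2 : ℂ) • ((bondRoot N x y)ᴴ * bondRoot N x y) := by
  have h1 : (bondRoot N x y)ᴴ * bondRoot N x y =
      siteOp x (num N) * siteOp y (hole N * hole N) - siteOp x (spinPlus N) * siteOp y (spinMinus N)
      - siteOp x (spinMinus N) * siteOp y (spinPlus N)
      + siteOp x (hole N * hole N) * siteOp y (num N) := by
    rw [bondRoot, conjTranspose_sub, siteOp_mul_conjTranspose h, siteOp_mul_conjTranspose h,
      hole_conjTranspose, sub_mul, mul_sub, mul_sub]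
    simp only [siteOp_mul_mul h]
    rw [annih_conjTranspose_mul, ← spinMinus_eq, ← spinPlus_eq]
    abel
  have hI : (1 / (2 * Complex.I)) * (1 / (2 * Complex.I)) = -(1 / 4 : ℂ) := by
    rw [div_mul_div_comm, show 2 * Complex.I * (2 * Complex.I) = 4 * (Complex.I * Complex.I) by ring,
      Complex.I_mul_I]
    norm_num
  have h2 : siteOp x (spin2 N) * siteOp y (spin2 N) = -(1 / 4 : ℂ) •
      (siteOp x (spinPlus N - spinMinus N) * siteOp y (spinPlus N - spinMinus N)) := by
    rw [spin2, siteOp_smul, siteOp_smul, smul_mul_assoc, mul_smul_comm, smul_smul, hI]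
  rw [h1, bondOp, spinDot, h2, spin1, hole_mul_hole, spin3_eq, spin]
  simp only [siteOp_add, siteOp_sub, siteOp_smul, siteOp_one, mul_add, add_mul, mul_sub, sub_mul,
    smul_mul_assoc, mul_smul_comm, mul_one, one_mul]
  push_cast
  module

end HolsteinPrimakoff

end Heisenberg

namespace Heisenberg

open Matrix

/-! ### Elementary facts on quadratic forms. -/

section QuadraticForms

variable {n : Type*} [Fintype n]

lemma normSq_nonneg (v : n → ℂ) : 0 ≤ normSq v := Finset.sum_nonneg fun _ _ => by positivity

lemma dotProduct_star_self (v : n → ℂ) : star v ⬝ᵥ v = (normSq v : ℂ) := by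
  rw [dotProduct, normSq, Complex.ofReal_sum]
  refine Finset.sum_congr rfl fun i _ => ?_
  rw [Pi.star_apply, Complex.star_def, Complex.conj_mul']
  push_cast
  rfl

lemma quadForm_add (A B : Matrix n n ℂ) (v : n → ℂ) :
    quadForm (A + B) v = quadForm A v + quadForm B v := by
  simp [quadForm, add_mulVec, dotProduct_add]

lemma quadForm_sum {ι : Type*} (s : Finset ι) (A : ι → Matrix n n ℂ) (v : n → ℂ) :
    quadForm (∑ i ∈ s, A i) v = ∑ i ∈ s, quadForm (A i) v := by
  classical
  induction s using Finset.induction_on with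
  | empty => simp [quadForm]
  | insert a s ha ih => rw [Finset.sum_insert ha, Finset.sum_insert ha, quadForm_add, ih]

lemma quadForm_zero (v : n → ℂ) : quadForm (0 : Matrix n n ℂ) v = 0 := by
  simp [quadForm]

lemma quadForm_real_smul (c : ℝ) (A : Matrix n n ℂ) (v : n → ℂ) :
    quadForm ((c : ℂ) • A) v = c * quadForm A v := by
  simp [quadForm, smul_mulVec]

lemma quadForm_conjTranspose_mul (D : Matrix n n ℂ) (v : n → ℂ) :
    quadForm (Dᴴ * D) v = normSq (D *ᵥ v) := by
  rw [quadForm, ← mulVec_mulVec, dotProduct_mulVec, ← star_mulVec, dotProduct_star_self,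
    Complex.ofReal_re]

lemma quadForm_diagonal [DecidableEq n] (d : n → ℝ) (v : n → ℂ) :
    quadForm (diagonal fun i => (d i : ℂ)) v = ∑ i, d i * ‖v i‖ ^ 2 := by
  rw [quadForm, dotProduct, Complex.re_sum]
  refine Finset.sum_congr rfl fun i _ => ?_
  rw [mulVec_diagonal, Pi.star_apply, Complex.star_def,
    show ∀ a b : ℂ, (starRingEnd ℂ) b * (a * b) = a * ((starRingEnd ℂ) b * b) by intros; ring,
    Complex.conj_mul', ← Complex.ofReal_pow, ← Complex.ofReal_mul, Complex.ofReal_re]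

lemma normSq_sub_le (v w : n → ℂ) : normSq (v - w) ≤ 2 * (normSq v + normSq w) := by
  simp only [normSq]
  rw [← Finset.sum_add_distrib, Finset.mul_sum]
  refine Finset.sum_le_sum fun i _ => ?_
  have h1 := norm_sub_le (v i) (w i)
  have h2 := norm_nonneg (v i - w i)
  rw [Pi.sub_apply]
  nlinarith [sq_nonneg (‖v i‖ - ‖w i‖)]

end QuadraticForms

/-! ### Dirichlet boundary conditions. -/

section Dirichlet

variable (N : ℕ) {L : ℕ}

lemma bondOp_isHermitian {x y : Fin L} (h : x ≠ y) : (bondOp N x y).IsHermitian := by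
  rw [bondOp_eq N h, IsHermitian, conjTranspose_smul, conjTranspose_mul, conjTranspose_conjTranspose]
  simp

lemma quadForm_bondOp {x y : Fin L} (h : x ≠ y) (v : Config N L → ℂ) :
    quadForm (bondOp N x y) v = 1 / 2 * normSq (bondRoot N x y *ᵥ v) := by
  rw [bondOp_eq N h, show (1 / 2 : ℂ) = ((1 / 2 : ℝ) : ℂ) by push_cast; rfl, quadForm_real_smul,
    quadForm_conjTranspose_mul]

/-- The density of configurations in which the site `x` is not in the vacuum state. -/
def occupied (x : Fin L) (v : Config N L → ℂ) : ℝ :=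
  ∑ σ, (if σ x = 0 then 0 else 1) * ‖v σ‖ ^ 2

lemma occupied_nonneg (x : Fin L) (v : Config N L → ℂ) : 0 ≤ occupied N x v :=
  Finset.sum_nonneg fun σ _ => by split_ifs <;> positivity

lemma occupied_le (x : Fin L) (v : Config N L → ℂ) : occupied N x v ≤ normSq v := by
  refine Finset.sum_le_sum fun σ _ => ?_
  split_ifs
  · rw [zero_mul]; positivity
  · rw [one_mul]

lemma normSq_annih_hole_le {x y : Fin L} (h : x ≠ y) (v : Config N L → ℂ) :
    normSq ((siteOp x (annih N) * siteOp y (hole N)) *ᵥ v) ≤ (N : ℝ) ^ 2 * occupied N x v := by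
  have h1 : (siteOp x (annih N) * siteOp y (hole N))ᴴ * (siteOp x (annih N) * siteOp y (hole N))
      = diagonal fun σ : Config N L => (((((σ x : ℕ) : ℝ) * ((N : ℝ) - ((σ y : ℕ) : ℝ))) : ℝ) : ℂ)
      := by
    rw [siteOp_mul_conjTranspose h, siteOp_mul_mul h, annih_conjTranspose_mul, hole_conjTranspose,
      hole_mul_hole, num, ← diagonal_one, ← diagonal_smul, diagonal_sub, siteOp_diagonal,
      siteOp_diagonal, diagonal_mul_diagonal]
    congr 1
    ext σ
    simp
  rw [← quadForm_conjTranspose_mul, h1, quadForm_diagonal, occupied, Finset.mul_sum]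
  refine Finset.sum_le_sum fun σ _ => ?_
  rw [← mul_assoc]
  refine mul_le_mul_of_nonneg_right ?_ (by positivity)
  have hx := cast_le_of_fin (σ x)
  have hy : (0 : ℝ) ≤ (σ y : ℕ) := Nat.cast_nonneg _
  have hx0 : (0 : ℝ) ≤ (σ x : ℕ) := Nat.cast_nonneg _
  have hy' := cast_le_of_fin (σ y)
  split_ifs with h0
  · rw [h0]; simp
  · rw [mul_one, sq]
    exact mul_le_mul hx (by linarith) (by linarith) (Nat.cast_nonneg _)

/-- Both terms of the root annihilate a boson, so each vanishes where its site is empty; elsewhere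
`n_x (2S - n_y) ≤ (2S)²`. This fixes the strength `N ^ 2` of the boundary potential: it has to
dominate a bond that joins two blocks. -/
lemma quadForm_bondOp_le {x y : Fin L} (h : x ≠ y) (v : Config N L → ℂ) :
    quadForm (bondOp N x y) v ≤ (N : ℝ) ^ 2 * (occupied N x v + occupied N y v) := by
  rw [quadForm_bondOp N h, bondRoot, sub_mulVec]
  have h1 := normSq_sub_le ((siteOp x (annih N) * siteOp y (hole N)) *ᵥ v)
    ((siteOp x (hole N) * siteOp y (annih N)) *ᵥ v)
  have h2 := normSq_annih_hole_le N h v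
  have h3 := normSq_annih_hole_le N h.symm v
  rw [siteOp_comm h.symm] at h3
  linarith

lemma quadForm_bondOp_nonneg {x y : Fin L} (h : x ≠ y) (v : Config N L → ℂ) :
    0 ≤ quadForm (bondOp N x y) v := by
  rw [quadForm_bondOp N h]
  have := normSq_nonneg (bondRoot N x y *ᵥ v)
  positivity

/-- The weights of the boundary potential. -/
def boundaryWeight (x : Fin L) : ℝ :=
  (if (x : ℕ) = 0 then 1 else 0) + (if (x : ℕ) + 1 = L then 1 else 0)

/-- The potential that penalizes particles at the two ends of the chain. -/
def boundaryPotential (L : ℕ) : Matrix (Config N L) (Config N L) ℂ :=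
  diagonal fun σ =>
    ((∑ x : Fin L, (N : ℝ) ^ 2 * boundaryWeight x * (if σ x = 0 then 0 else 1) : ℝ) : ℂ)

/-- The Hamiltonian with Dirichlet boundary conditions. -/
def dirichletHamiltonian (L : ℕ) : Matrix (Config N L) (Config N L) ℂ :=
  hamiltonian N L + boundaryPotential N L

lemma hamiltonian_eq (L : ℕ) : hamiltonian N L =
    ∑ x : Fin L, ∑ y : Fin L, if (x : ℕ) + 1 = (y : ℕ) then bondOp N x y else 0 := rfl

lemma hamiltonian_isHermitian (L : ℕ) : (hamiltonian N L).IsHermitian := by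
  rw [hamiltonian_eq]
  simp only [IsHermitian, conjTranspose_sum]
  refine Finset.sum_congr rfl fun x _ => Finset.sum_congr rfl fun y _ => ?_
  split_ifs with h
  · exact bondOp_isHermitian N (by rintro rfl; omega)
  · simp

lemma boundaryPotential_isHermitian (L : ℕ) : (boundaryPotential N L).IsHermitian := by
  rw [IsHermitian, boundaryPotential, diagonal_conjTranspose]
  congr 1
  ext σ
  rw [Pi.star_apply, Complex.star_def, Complex.conj_ofReal]

lemma dirichletHamiltonian_isHermitian (L : ℕ) : (dirichletHamiltonian N L).IsHermitian :=
  (hamiltonian_isHermitian N L).add (boundaryPotential_isHermitian N L)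

lemma quadForm_hamiltonian (v : Config N L → ℂ) : quadForm (hamiltonian N L) v =
    ∑ x : Fin L, ∑ y : Fin L, if (x : ℕ) + 1 = (y : ℕ) then quadForm (bondOp N x y) v else 0 := by
  rw [hamiltonian_eq, quadForm_sum]
  refine Finset.sum_congr rfl fun x _ => ?_
  rw [quadForm_sum]
  refine Finset.sum_congr rfl fun y _ => ?_
  split_ifs
  · rfl
  · rw [quadForm_zero]

lemma quadForm_boundaryPotential (v : Config N L → ℂ) : quadForm (boundaryPotential N L) v =
    ∑ x : Fin L, (N : ℝ) ^ 2 * boundaryWeight x * occupied N x v := by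
  rw [boundaryPotential, quadForm_diagonal]
  simp_rw [occupied, Finset.sum_mul, Finset.mul_sum]
  rw [Finset.sum_comm]
  simp_rw [mul_assoc]

lemma quadForm_dirichletHamiltonian (v : Config N L → ℂ) : quadForm (dirichletHamiltonian N L) v =
    (∑ x : Fin L, ∑ y : Fin L, if (x : ℕ) + 1 = (y : ℕ) then quadForm (bondOp N x y) v else 0)
    + ∑ x : Fin L, (N : ℝ) ^ 2 * boundaryWeight x * occupied N x v := by
  rw [dirichletHamiltonian, quadForm_add, quadForm_hamiltonian, quadForm_boundaryPotential]

lemma quadForm_hamiltonian_nonneg (v : Config N L → ℂ) : 0 ≤ quadForm (hamiltonian N L) v := by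
  rw [quadForm_hamiltonian]
  refine Finset.sum_nonneg fun x _ => Finset.sum_nonneg fun y _ => ?_
  split_ifs with h
  · exact quadForm_bondOp_nonneg N (by rintro rfl; omega) v
  · rfl

lemma boundaryWeight_nonneg (x : Fin L) : 0 ≤ boundaryWeight x := by
  rw [boundaryWeight]; split_ifs <;> norm_num

lemma sum_boundaryWeight_le (L : ℕ) : ∑ x : Fin L, boundaryWeight x ≤ 2 := by
  simp only [boundaryWeight]
  rw [Finset.sum_add_distrib, Finset.sum_boole, Finset.sum_boole]
  have h1 : (Finset.univ.filter fun x : Fin L => (x : ℕ) = 0).card ≤ 1 :=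
    Finset.card_le_one.2 fun a ha b hb => by
      simp only [Finset.mem_filter] at ha hb; exact Fin.ext (by omega)
  have h2 : (Finset.univ.filter fun x : Fin L => (x : ℕ) + 1 = L).card ≤ 1 :=
    Finset.card_le_one.2 fun a ha b hb => by
      simp only [Finset.mem_filter] at ha hb; exact Fin.ext (by omega)
  have h1' : ((Finset.univ.filter fun x : Fin L => (x : ℕ) = 0).card : ℝ) ≤ 1 := by exact_mod_cast h1
  have h2' : ((Finset.univ.filter fun x : Fin L => (x : ℕ) + 1 = L).card : ℝ) ≤ 1 := by
    exact_mod_cast h2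
  linarith

lemma quadForm_boundaryPotential_nonneg (v : Config N L → ℂ) :
    0 ≤ quadForm (boundaryPotential N L) v := by
  rw [quadForm_boundaryPotential]
  exact Finset.sum_nonneg fun x _ => mul_nonneg
    (mul_nonneg (by positivity) (boundaryWeight_nonneg x)) (occupied_nonneg N x v)

lemma quadForm_boundaryPotential_le (v : Config N L → ℂ) :
    quadForm (boundaryPotential N L) v ≤ 2 * (N : ℝ) ^ 2 * normSq v := by
  rw [quadForm_boundaryPotential]
  calc _ ≤ ∑ x : Fin L, (N : ℝ) ^ 2 * boundaryWeight x * normSq v := by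
        refine Finset.sum_le_sum fun x _ => mul_le_mul_of_nonneg_left (occupied_le N x v) ?_
        exact mul_nonneg (by positivity) (boundaryWeight_nonneg x)
    _ = (N : ℝ) ^ 2 * (∑ x : Fin L, boundaryWeight x) * normSq v := by
        rw [Finset.mul_sum, Finset.sum_mul]
    _ ≤ (N : ℝ) ^ 2 * 2 * normSq v := by
        have := sum_boundaryWeight_le L
        have := normSq_nonneg v
        gcongr
    _ = _ := by ring

end Dirichlet

/-! ### Joining two chains. -/

section Tensor

variable {N L M : ℕ}

/-- The tensor product of states of two adjacent chains. -/
def tens (ψ : Config N L → ℂ) (χ : Config N M → ℂ) : Config N (L + M) → ℂ :=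
  fun σ => ψ (fun i => σ (Fin.castAdd M i)) * χ (fun j => σ (Fin.natAdd L j))

lemma sum_config_add {R : Type*} [AddCommMonoid R] (f : Config N L → Config N M → R) :
    ∑ σ : Config N (L + M), f (fun i => σ (Fin.castAdd M i)) (fun j => σ (Fin.natAdd L j))
      = ∑ σ, ∑ τ, f σ τ := by
  rw [← Fintype.sum_prod_type']
  refine Fintype.sum_equiv (Fin.appendEquiv L M).symm _ _ fun σ => ?_
  rfl

lemma star_tens_dotProduct (ψ ψ' : Config N L → ℂ) (χ χ' : Config N M → ℂ) :
    star (tens ψ χ) ⬝ᵥ tens ψ' χ' = (star ψ ⬝ᵥ ψ') * (star χ ⬝ᵥ χ') := by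
  simp only [dotProduct, tens, Pi.star_apply]
  rw [sum_config_add (fun σ τ => star (ψ σ * χ τ) * (ψ' σ * χ' τ)), Finset.sum_mul_sum]
  refine Finset.sum_congr rfl fun σ _ => Finset.sum_congr rfl fun τ _ => ?_
  rw [star_mul']
  ring

lemma normSq_tens (ψ : Config N L → ℂ) (χ : Config N M → ℂ) :
    normSq (tens ψ χ) = normSq ψ * normSq χ := by
  have h := star_tens_dotProduct ψ ψ χ χ
  rw [dotProduct_star_self, dotProduct_star_self, dotProduct_star_self] at h
  exact_mod_cast h

lemma siteOp_castAdd_mulVec (x : Fin L) (A : Matrix (Fin (N + 1)) (Fin (N + 1)) ℂ)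
    (ψ : Config N L → ℂ) (χ : Config N M → ℂ) :
    siteOp (Fin.castAdd M x) A *ᵥ tens ψ χ = tens (siteOp x A *ᵥ ψ) χ := by
  ext σ
  rw [siteOp_mulVec, tens, siteOp_mulVec, Finset.sum_mul]
  refine Finset.sum_congr rfl fun k _ => ?_
  rw [tens, mul_assoc]
  congr 3
  · ext i
    by_cases h : i = x
    · subst h; simp
    · rw [Function.update_of_ne h, Function.update_of_ne]
      simpa using h
  · ext j
    rw [Function.update_of_ne]
    intro h
    have := congrArg Fin.val h
    simp at this
    omega

lemma siteOp_natAdd_mulVec (x : Fin M) (A : Matrix (Fin (N + 1)) (Fin (N + 1)) ℂ)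
    (ψ : Config N L → ℂ) (χ : Config N M → ℂ) :
    siteOp (Fin.natAdd L x) A *ᵥ tens ψ χ = tens ψ (siteOp x A *ᵥ χ) := by
  ext σ
  rw [siteOp_mulVec, tens, siteOp_mulVec, Finset.mul_sum]
  refine Finset.sum_congr rfl fun k _ => ?_
  rw [tens, mul_left_comm]
  congr 3
  · ext i
    rw [Function.update_of_ne]
    intro h
    have := congrArg Fin.val h
    simp at this
    omega
  · ext j
    by_cases h : j = x
    · subst h; simp
    · rw [Function.update_of_ne h, Function.update_of_ne]
      simpa using h

lemma quadForm_bondOp_castAdd {x y : Fin L} (h : x ≠ y) (ψ : Config N L → ℂ) (χ : Config N M → ℂ) :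
    quadForm (bondOp N (Fin.castAdd M x) (Fin.castAdd M y)) (tens ψ χ)
      = quadForm (bondOp N x y) ψ * normSq χ := by
  have h' : Fin.castAdd M x ≠ Fin.castAdd M y := by simpa using h
  rw [quadForm_bondOp N h', quadForm_bondOp N h, mul_assoc, ← normSq_tens]
  congr 2
  simp only [bondRoot, sub_mulVec, ← mulVec_mulVec, siteOp_castAdd_mulVec]
  ext σ
  simp [tens, sub_mul]

lemma quadForm_bondOp_natAdd {x y : Fin M} (h : x ≠ y) (ψ : Config N L → ℂ) (χ : Config N M → ℂ) :
    quadForm (bondOp N (Fin.natAdd L x) (Fin.natAdd L y)) (tens ψ χ)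
      = normSq ψ * quadForm (bondOp N x y) χ := by
  have h' : Fin.natAdd L x ≠ Fin.natAdd L y := by simpa using h
  rw [quadForm_bondOp N h', quadForm_bondOp N h, mul_left_comm, ← normSq_tens]
  congr 2
  simp only [bondRoot, sub_mulVec, ← mulVec_mulVec, siteOp_natAdd_mulVec]
  ext σ
  simp [tens, mul_sub]

lemma occupied_castAdd (x : Fin L) (ψ : Config N L → ℂ) (χ : Config N M → ℂ) :
    occupied N (Fin.castAdd M x) (tens ψ χ) = occupied N x ψ * normSq χ := by
  simp only [occupied, tens, normSq]
  rw [sum_config_add (fun σ τ => (if σ x = 0 then (0 : ℝ) else 1) * ‖ψ σ * χ τ‖ ^ 2),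
    Finset.sum_mul_sum]
  refine Finset.sum_congr rfl fun σ _ => Finset.sum_congr rfl fun τ _ => ?_
  rw [norm_mul, mul_pow, mul_assoc]

lemma occupied_natAdd (x : Fin M) (ψ : Config N L → ℂ) (χ : Config N M → ℂ) :
    occupied N (Fin.natAdd L x) (tens ψ χ) = normSq ψ * occupied N x χ := by
  simp only [occupied, tens, normSq]
  rw [sum_config_add (fun σ τ => (if τ x = 0 then (0 : ℝ) else 1) * ‖ψ σ * χ τ‖ ^ 2),
    Finset.sum_mul_sum]
  refine Finset.sum_congr rfl fun σ _ => Finset.sum_congr rfl fun τ _ => ?_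
  rw [norm_mul, mul_pow, mul_left_comm]

/-- The long chain gains one bond at the junction but loses the potentials on the two sites there,
and `quadForm_bondOp_le` says that these potentials pay for the bond. Both chains must be nonempty
for the junction to exist. -/
lemma quadForm_dirichletHamiltonian_tens_le (hL : L ≠ 0) (hM : M ≠ 0)
    (ψ : Config N L → ℂ) (χ : Config N M → ℂ) :
    quadForm (dirichletHamiltonian N (L + M)) (tens ψ χ)
      ≤ quadForm (dirichletHamiltonian N L) ψ * normSq χ
        + normSq ψ * quadForm (dirichletHamiltonian N M) χ := by
  obtain ⟨L, rfl⟩ := Nat.exists_eq_succ_of_ne_zero hL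
  obtain ⟨M, rfl⟩ := Nat.exists_eq_succ_of_ne_zero hM
  simp only [quadForm_dirichletHamiltonian, Fin.sum_univ_add (a := L.succ) (b := M.succ),
    Fin.val_castAdd, Fin.val_natAdd]
  have hne : ∀ {k : ℕ} {x y : Fin k}, (x : ℕ) + 1 = y → x ≠ y := by
    rintro k x y h rfl; omega
  have e1 : ∀ x y : Fin L.succ, (if (x : ℕ) + 1 = y then
      quadForm (bondOp N (Fin.castAdd M.succ x) (Fin.castAdd M.succ y)) (tens ψ χ) else 0)
      = (if (x : ℕ) + 1 = y then quadForm (bondOp N x y) ψ else 0) * normSq χ := by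
    intro x y
    split_ifs with h
    · exact quadForm_bondOp_castAdd (hne h) ψ χ
    · simp
  have e2 : ∀ x y : Fin M.succ, (if L.succ + (x : ℕ) + 1 = L.succ + y then
      quadForm (bondOp N (Fin.natAdd L.succ x) (Fin.natAdd L.succ y)) (tens ψ χ) else 0)
      = normSq ψ * (if (x : ℕ) + 1 = y then quadForm (bondOp N x y) χ else 0) := by
    intro x y
    by_cases h : (x : ℕ) + 1 = y
    · rw [if_pos h, if_pos (by omega)]
      exact quadForm_bondOp_natAdd (hne h) ψ χ
    · rw [if_neg h, if_neg (by omega), mul_zero]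
  have e3 : ∀ (x : Fin M.succ) (y : Fin L.succ), (if L.succ + (x : ℕ) + 1 = y then
      quadForm (bondOp N (Fin.natAdd L.succ x) (Fin.castAdd M.succ y)) (tens ψ χ) else 0) = 0 := by
    intro x y
    rw [if_neg (by omega)]
  -- Only the last site of the left chain and the first site of the right chain are neighbours.
  have e4 : ∑ x : Fin L.succ, ∑ y : Fin M.succ, (if (x : ℕ) + 1 = L.succ + y then
      quadForm (bondOp N (Fin.castAdd M.succ x) (Fin.natAdd L.succ y)) (tens ψ χ) else 0)
      ≤ (N : ℝ) ^ 2 * (occupied N (Fin.last L) ψ * normSq χ + normSq ψ * occupied N 0 χ) := by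
    rw [Finset.sum_eq_single (Fin.last L), Finset.sum_eq_single (0 : Fin M.succ), if_pos (by simp)]
    · rw [← occupied_castAdd, ← occupied_natAdd]
      refine quadForm_bondOp_le N (fun h => ?_) _
      have := congrArg Fin.val h
      simp at this
    · intro y _ hy
      have : (y : ℕ) ≠ 0 := fun h => hy (Fin.ext h)
      rw [if_neg]
      simp only [Fin.val_last]; omega
    · simp
    · intro x _ hx
      have : (x : ℕ) ≠ L := fun h => hx (Fin.ext h)
      refine Finset.sum_eq_zero fun y _ => ?_
      rw [if_neg]
      omega
    · simp
  -- The right end of the left chain becomes an interior site and loses one unit of weight; if that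
  -- chain has a single site, it keeps the unit of its left end.
  have e5 : ∑ x : Fin L.succ, (N : ℝ) ^ 2 * boundaryWeight (Fin.castAdd M.succ x)
      * occupied N (Fin.castAdd M.succ x) (tens ψ χ)
      = (∑ x : Fin L.succ, (N : ℝ) ^ 2 * boundaryWeight x * occupied N x ψ) * normSq χ
        - (N : ℝ) ^ 2 * (occupied N (Fin.last L) ψ * normSq χ) := by
    have h1 : ∀ x : Fin L.succ, boundaryWeight (Fin.castAdd M.succ x)
        = boundaryWeight x - if x = Fin.last L then 1 else 0 := by
      intro x
      simp only [boundaryWeight, Fin.val_castAdd]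
      rw [if_neg (show ¬ (x : ℕ) + 1 = L.succ + M.succ by omega)]
      by_cases hx : x = Fin.last L
      · rw [if_pos hx, if_pos (show (x : ℕ) + 1 = L.succ by rw [hx]; simp)]; ring
      · have : (x : ℕ) ≠ L := fun h => hx (Fin.ext h)
        rw [if_neg hx, if_neg (show ¬ (x : ℕ) + 1 = L.succ by omega)]; ring
    simp_rw [h1, occupied_castAdd, mul_sub, sub_mul, Finset.sum_sub_distrib]
    rw [Finset.sum_mul]
    congr 1
    · simp_rw [mul_assoc]
    · simp
  have e6 : ∑ x : Fin M.succ, (N : ℝ) ^ 2 * boundaryWeight (Fin.natAdd L.succ x)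
      * occupied N (Fin.natAdd L.succ x) (tens ψ χ)
      = normSq ψ * (∑ x : Fin M.succ, (N : ℝ) ^ 2 * boundaryWeight x * occupied N x χ)
        - (N : ℝ) ^ 2 * (normSq ψ * occupied N 0 χ) := by
    have h1 : ∀ x : Fin M.succ, boundaryWeight (Fin.natAdd L.succ x)
        = boundaryWeight x - if x = 0 then 1 else 0 := by
      intro x
      simp only [boundaryWeight, Fin.val_natAdd]
      rw [if_neg (show ¬ L.succ + (x : ℕ) = 0 by omega)]
      have h2 : (L.succ + (x : ℕ) + 1 = L.succ + M.succ) ↔ ((x : ℕ) + 1 = M.succ) := by omega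
      simp only [h2]
      by_cases hx : x = 0
      · rw [if_pos hx, if_pos (show (x : ℕ) = 0 by rw [hx]; simp)]; ring
      · have : (x : ℕ) ≠ 0 := fun h => hx (Fin.ext h)
        rw [if_neg hx, if_neg this]; ring
    simp_rw [h1, occupied_natAdd, mul_sub, sub_mul, Finset.sum_sub_distrib]
    rw [Finset.mul_sum]
    congr 1
    · refine Finset.sum_congr rfl fun x _ => by ring
    · simp
  simp_rw [e1, e2, e3, Finset.sum_add_distrib]
  rw [e5, e6]
  simp_rw [← Finset.sum_mul, ← Finset.mul_sum]
  simp only [Finset.sum_const_zero]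
  linarith

end Tensor

end Heisenberg

namespace Heisenberg

open Matrix

/-! ### Superadditivity and the thermodynamic limit. -/

section ThermodynamicLimit

variable (N : ℕ)

/-- The partition function with Dirichlet boundary conditions. -/
def dirichletPartition (β : ℝ) (L : ℕ) : ℝ := gibbsTrace β (dirichletHamiltonian N L)

lemma dirichletPartition_pos (β : ℝ) (L : ℕ) : 0 < dirichletPartition N β L :=
  gibbsTrace_pos (dirichletHamiltonian_isHermitian N L) β

lemma dirichletPartition_zero (β : ℝ) : dirichletPartition N β 0 = 1 := by
  have h : dirichletHamiltonian N 0 = 0 := by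
    rw [dirichletHamiltonian, hamiltonian, boundaryPotential]
    simp
  rw [dirichletPartition, gibbsTrace, h, smul_zero, NormedSpace.exp_zero, trace_one]
  simp

lemma orthonormal_tens {L M : ℕ} {ι κ : Type*} {ψ : ι → Config N L → ℂ} {χ : κ → Config N M → ℂ}
    (hψ : Orthonormal ℂ fun i => (WithLp.toLp 2 (ψ i) : EuclideanSpace ℂ (Config N L)))
    (hχ : Orthonormal ℂ fun i => (WithLp.toLp 2 (χ i) : EuclideanSpace ℂ (Config N M))) :
    Orthonormal ℂ fun p : ι × κ =>
      (WithLp.toLp 2 (tens (ψ p.1) (χ p.2)) : EuclideanSpace ℂ (Config N (L + M))) := by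
  classical
  rw [orthonormal_iff_ite] at *
  intro p q
  have h1 := hψ p.1 q.1
  have h2 := hχ p.2 q.2
  rw [EuclideanSpace.inner_eq_star_dotProduct, dotProduct_comm] at *
  rw [star_tens_dotProduct, h1, h2]
  simp only [Prod.ext_iff]
  split_ifs <;> simp_all

/-- Tensor products of eigenvectors of the two blocks serve as trial states, with the sum of the two
eigenvalues as reference energy. -/
lemma dirichletPartition_mul_le {β : ℝ} (hβ : 0 ≤ β) (L M : ℕ) :
    dirichletPartition N β L * dirichletPartition N β M ≤ dirichletPartition N β (L + M) := by
  rcases eq_or_ne L 0 with rfl | hL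
  · rw [dirichletPartition_zero, one_mul, zero_add]
  rcases eq_or_ne M 0 with rfl | hM
  · rw [dirichletPartition_zero, mul_one, add_zero]
  have hA := dirichletHamiltonian_isHermitian N L
  have hB := dirichletHamiltonian_isHermitian N M
  have ho := orthonormal_tens N (ψ := fun i => ⇑(hA.eigenvectorBasis i))
    (χ := fun i => ⇑(hB.eigenvectorBasis i)) hA.eigenvectorBasis.orthonormal hB.eigenvectorBasis.orthonormal
  have hb := isBessel_of_orthonormal Finset.univ ho
  refine le_trans ?_ (le_gibbsTrace (dirichletHamiltonian_isHermitian N (L + M)) β hb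
    fun p => β * (hA.eigenvalues p.1 + hB.eigenvalues p.2))
  rw [dirichletPartition, dirichletPartition, gibbsTrace_eq_sum hA, gibbsTrace_eq_sum hB,
    Finset.sum_mul_sum, ← Finset.univ_product_univ, Finset.sum_product]
  refine Finset.sum_le_sum fun i _ => Finset.sum_le_sum fun j _ => ?_
  have h1 := quadForm_dirichletHamiltonian_tens_le hL hM (⇑(hA.eigenvectorBasis i))
    (⇑(hB.eigenvectorBasis j))
  rw [normSq_eigenvector, normSq_eigenvector, quadForm_eigenvector, quadForm_eigenvector] at h1
  simp only []
  rw [normSq_tens, normSq_eigenvector, normSq_eigenvector, ← Real.exp_add]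
  have h2 := mul_le_mul_of_nonneg_left h1 hβ
  calc _ = Real.exp (-(β * (hA.eigenvalues i + hB.eigenvalues j))) * 1 := by ring_nf
    _ ≤ _ := by gcongr; linarith

/-- Both parts of the Hamiltonian are nonnegative, so the trace is at most the dimension. This is
the lower bound that Fekete's lemma needs. -/
lemma dirichletPartition_le {β : ℝ} (hβ : 0 ≤ β) (L : ℕ) :
    dirichletPartition N β L ≤ ((N : ℝ) + 1) ^ L := by
  have hA := dirichletHamiltonian_isHermitian N L
  rw [dirichletPartition, gibbsTrace_eq_sum hA]
  calc _ ≤ ∑ i : Config N L, (1 : ℝ) := by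
        refine Finset.sum_le_sum fun i _ => Real.exp_le_one_iff.2 ?_
        have h1 : 0 ≤ hA.eigenvalues i := by
          rw [← quadForm_eigenvector hA, quadForm_dirichletHamiltonian, ← quadForm_hamiltonian,
            ← quadForm_boundaryPotential]
          exact add_nonneg (quadForm_hamiltonian_nonneg N _) (quadForm_boundaryPotential_nonneg N _)
        nlinarith
    _ = _ := by simp

lemma dirichletPartition_le_partitionFunction {β : ℝ} (hβ : 0 ≤ β) (L : ℕ) :
    dirichletPartition N β L ≤ partitionFunction N L β := by
  have h := gibbsTrace_le_exp_mul (hamiltonian_isHermitian N L)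
    (dirichletHamiltonian_isHermitian N L) hβ 0 fun v => by
      rw [dirichletHamiltonian, quadForm_add]
      have := quadForm_boundaryPotential_nonneg N v
      linarith
  rw [mul_zero, neg_zero, Real.exp_zero, one_mul] at h
  exact h

lemma partitionFunction_le {β : ℝ} (hβ : 0 ≤ β) (L : ℕ) :
    Real.exp (-(β * (2 * (N : ℝ) ^ 2))) * partitionFunction N L β ≤ dirichletPartition N β L :=
  gibbsTrace_le_exp_mul (dirichletHamiltonian_isHermitian N L) (hamiltonian_isHermitian N L) hβ _
    fun v => by
      rw [dirichletHamiltonian, quadForm_add]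
      have := quadForm_boundaryPotential_le N v
      linarith

lemma subadditive_neg_log_dirichletPartition {β : ℝ} (hβ : 0 ≤ β) :
    Subadditive fun L => -Real.log (dirichletPartition N β L) := by
  intro L M
  have h1 := dirichletPartition_pos N β L
  have h2 := dirichletPartition_pos N β M
  have h := Real.log_le_log (mul_pos h1 h2) (dirichletPartition_mul_le N hβ L M)
  rw [Real.log_mul h1.ne' h2.ne'] at h
  linarith

lemma bddBelow_neg_log_dirichletPartition {β : ℝ} (hβ : 0 ≤ β) :
    BddBelow (Set.range fun L : ℕ => -Real.log (dirichletPartition N β L) / L) := by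
  refine ⟨-Real.log ((N : ℝ) + 1), ?_⟩
  rintro _ ⟨L, rfl⟩
  have h0 : 0 ≤ Real.log ((N : ℝ) + 1) :=
    Real.log_nonneg (by have : (0 : ℝ) ≤ N := Nat.cast_nonneg N; linarith)
  rcases eq_or_ne L 0 with rfl | hL
  · simpa using h0
  have hL' : (0 : ℝ) < L := by positivity
  have h := Real.log_le_log (dirichletPartition_pos N β L) (dirichletPartition_le N hβ L)
  rw [Real.log_pow] at h
  show _ ≤ -Real.log (dirichletPartition N β L) / L
  rw [le_div_iff₀ hL']
  linarith

/-- Fekete's lemma treats the Dirichlet chain. Open and Dirichlet partition functions differ at most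
by the factor `exp (2 β N²)`, which does not depend on `L` and disappears after division by `L`. -/
lemma tendsto_finiteFreeEnergy_lim {β : ℝ} (hβ : 0 < β) :
    Tendsto (fun L : ℕ => finiteFreeEnergy N L β) atTop
      (𝓝 (1 / β * (subadditive_neg_log_dirichletPartition N hβ.le).lim)) := by
  have h1 := (subadditive_neg_log_dirichletPartition N hβ.le).tendsto_lim
    (bddBelow_neg_log_dirichletPartition N hβ.le)
  have h2 : Tendsto (fun L : ℕ => (Real.log (dirichletPartition N β L)
      - Real.log (partitionFunction N L β)) / (L : ℝ)) atTop (𝓝 0) := by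
    refine squeeze_zero_norm (a := fun L : ℕ => (β * (2 * (N : ℝ) ^ 2)) / L) (fun L => ?_)
      (tendsto_const_div_atTop_nhds_zero_nat _)
    rw [norm_div, RCLike.norm_natCast]
    refine div_le_div_of_nonneg_right ?_ (Nat.cast_nonneg L)
    have hp := dirichletPartition_pos N β L
    have hq := hp.trans_le (dirichletPartition_le_partitionFunction N hβ.le L)
    have h3 := Real.log_le_log hp (dirichletPartition_le_partitionFunction N hβ.le L)
    have h4 := Real.log_le_log (by positivity) (partitionFunction_le N hβ.le L)
    rw [Real.log_mul (Real.exp_pos _).ne' hq.ne', Real.log_exp] at h4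
    rw [Real.norm_eq_abs, abs_le]
    constructor
    · linarith
    · have : 0 ≤ β * (2 * (N : ℝ) ^ 2) := by positivity
      linarith
  have h3 := (h1.add h2).const_mul (1 / β)
  rw [add_zero] at h3
  refine h3.congr fun L => ?_
  rw [finiteFreeEnergy]
  rw [one_div, one_div, mul_inv]
  ring

lemma tendsto_finiteFreeEnergy {β : ℝ} (hβ : 0 < β) :
    Tendsto (fun L : ℕ => finiteFreeEnergy N L β) atTop (𝓝 (freeEnergy N β)) := by
  have h := tendsto_finiteFreeEnergy_lim N hβ
  rw [freeEnergy, h.limUnder_eq]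
  exact h

/-- The limit of a subadditive sequence divided by its index is an infimum, so every single block
gives a bound. -/
lemma freeEnergy_le {β : ℝ} (hβ : 0 < β) {L : ℕ} (hL : L ≠ 0) :
    freeEnergy N β ≤ -(1 / (β * L)) * Real.log (dirichletPartition N β L) := by
  rw [freeEnergy, (tendsto_finiteFreeEnergy_lim N hβ).limUnder_eq]
  have h := (subadditive_neg_log_dirichletPartition N hβ.le).lim_le_div
    (bddBelow_neg_log_dirichletPartition N hβ.le) hL
  calc _ ≤ 1 / β * (-Real.log (dirichletPartition N β L) / L) := by gcongr
    _ = _ := by rw [one_div, one_div, mul_inv]; ring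

end ThermodynamicLimit

end Heisenberg

namespace Heisenberg

/-! ### The Fock space as a space of polynomials. -/

section FockSpace

open MvPolynomial

/-- The product of the factorials of the exponents of a monomial. -/
def multiFactorial {ι : Type*} [Fintype ι] (τ : ι →₀ ℕ) : ℝ := ∏ x, ((τ x).factorial : ℝ)

/-- The Fischer inner product of polynomials, in which `X x` is adjoint to `∂ / ∂ x`. -/
def fischer (ι : Type*) [Fintype ι] : MvPolynomial ι ℝ →ₗ[ℝ] MvPolynomial ι ℝ →ₗ[ℝ] ℝ :=
  (basisMonomials ι ℝ).constr ℝ fun τ => multiFactorial τ • lcoeff ℝ τ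

/-- Multiplication by `X x` creates and `pderiv x` annihilates a boson, so their product is the
number operator at `x`. -/
lemma coeff_X_mul_pderiv {ι : Type*} (x : ι) (p : MvPolynomial ι ℝ) (τ : ι →₀ ℕ) :
    coeff τ (X x * pderiv x p) = τ x * coeff τ p := by
  classical
  induction p using MvPolynomial.induction_on' with
  | add p₁ p₂ h₁ h₂ => rw [map_add, mul_add, coeff_add, h₁, h₂, coeff_add, mul_add]
  | monomial m a =>
    rw [X_mul_pderiv_monomial, coeff_smul, coeff_monomial]
    split_ifs with h
    · rw [h, nsmul_eq_mul]
    · simp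

lemma pderiv_comm {ι : Type*} (x y : ι) (p : MvPolynomial ι ℝ) :
    pderiv x (pderiv y p) = pderiv y (pderiv x p) := by
  classical
  ext τ
  simp only [coeff_pderiv, Finsupp.add_apply, Finsupp.single_apply]
  rw [add_right_comm]
  by_cases h : x = y
  · subst h; rfl
  · rw [if_neg h, if_neg fun h' => h h'.symm]
    push_cast
    ring

variable {ι : Type*} [Fintype ι]

lemma multiFactorial_pos (τ : ι →₀ ℕ) : 0 < multiFactorial τ :=
  Finset.prod_pos fun x _ => by exact_mod_cast Nat.factorial_pos _

lemma multiFactorial_add_single (τ : ι →₀ ℕ) (x : ι) :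
    multiFactorial (τ + Finsupp.single x 1) = (τ x + 1) * multiFactorial τ := by
  classical
  rw [multiFactorial, multiFactorial, ← Finset.mul_prod_erase _ _ (Finset.mem_univ x),
    ← Finset.mul_prod_erase (a := x) _ (fun x => ((τ x).factorial : ℝ)) (Finset.mem_univ x),
    ← mul_assoc]
  congr 1
  · simp [Nat.factorial_succ]
  · refine Finset.prod_congr rfl fun y hy => ?_
    rw [Finsupp.add_apply, Finsupp.single_eq_of_ne (Finset.ne_of_mem_erase hy), add_zero]

lemma fischer_sum_left {κ : Type*} (s : Finset κ) (f : κ → MvPolynomial ι ℝ)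
    (q : MvPolynomial ι ℝ) : fischer ι (∑ i ∈ s, f i) q = ∑ i ∈ s, fischer ι (f i) q := by
  rw [map_sum, LinearMap.sum_apply]

lemma fischer_sum_right {κ : Type*} (s : Finset κ) (f : κ → MvPolynomial ι ℝ)
    (p : MvPolynomial ι ℝ) : fischer ι p (∑ i ∈ s, f i) = ∑ i ∈ s, fischer ι p (f i) :=
  map_sum _ _ _

lemma fischer_smul_left (c : ℝ) (p q : MvPolynomial ι ℝ) :
    fischer ι (c • p) q = c * fischer ι p q := by
  rw [LinearMap.map_smul, LinearMap.smul_apply, smul_eq_mul]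

lemma fischer_smul_right (c : ℝ) (p q : MvPolynomial ι ℝ) :
    fischer ι p (c • q) = c * fischer ι p q := by
  rw [LinearMap.map_smul, smul_eq_mul]

lemma fischer_monomial (τ : ι →₀ ℕ) (c : ℝ) (q : MvPolynomial ι ℝ) :
    fischer ι (monomial τ c) q = c * multiFactorial τ * coeff τ q := by
  have h : monomial τ c = c • (basisMonomials ι ℝ) τ := by
    rw [coe_basisMonomials, smul_monomial, smul_eq_mul, mul_one]
  rw [h, fischer, LinearMap.map_smul, Module.Basis.constr_basis, LinearMap.smul_apply,
    LinearMap.smul_apply, lcoeff_apply, smul_eq_mul, smul_eq_mul, mul_assoc]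

lemma fischer_eq_sum {p : MvPolynomial ι ℝ} {s : Finset (ι →₀ ℕ)} (hs : p.support ⊆ s)
    (q : MvPolynomial ι ℝ) :
    fischer ι p q = ∑ τ ∈ s, multiFactorial τ * (coeff τ p * coeff τ q) := by
  conv_lhs => rw [← support_sum_monomial_coeff p]
  rw [map_sum, LinearMap.sum_apply]
  simp_rw [fischer_monomial]
  refine Finset.sum_subset_zero_on_sdiff hs (fun τ hτ => ?_) (fun τ _ => by ring)
  rw [notMem_support_iff.1 (Finset.mem_sdiff.1 hτ).2]
  ring

lemma fischer_comm (p q : MvPolynomial ι ℝ) : fischer ι p q = fischer ι q p := by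
  classical
  rw [fischer_eq_sum Finset.subset_union_left q (s := p.support ∪ q.support),
    fischer_eq_sum Finset.subset_union_right p (s := p.support ∪ q.support)]
  simp_rw [mul_comm (coeff _ p)]

lemma fischer_self_nonneg (p : MvPolynomial ι ℝ) : 0 ≤ fischer ι p p := by
  rw [fischer_eq_sum (Finset.Subset.refl _)]
  exact Finset.sum_nonneg fun τ _ => mul_nonneg (multiFactorial_pos τ).le (mul_self_nonneg _)

lemma fischer_X_mul (x : ι) (p q : MvPolynomial ι ℝ) :
    fischer ι (X x * p) q = fischer ι p (pderiv x q) := by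
  induction p using MvPolynomial.induction_on' with
  | add p₁ p₂ h₁ h₂ => rw [mul_add, map_add, map_add, LinearMap.add_apply, LinearMap.add_apply, h₁, h₂]
  | monomial τ c =>
    rw [X, monomial_mul, one_mul, add_comm, fischer_monomial, fischer_monomial, coeff_pderiv,
      multiFactorial_add_single]
    ring

lemma fischer_mul_X (x : ι) (p q : MvPolynomial ι ℝ) :
    fischer ι p (X x * q) = fischer ι (pderiv x p) q := by
  rw [fischer_comm, fischer_X_mul, fischer_comm]

/-- Normal ordering: `a* a* a a = n (n - 1)`. The left side thus counts ordered pairs of particles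
at `x`. -/
lemma fischer_pderiv_pderiv (x : ι) (p : MvPolynomial ι ℝ) :
    fischer ι (pderiv x (pderiv x p)) (pderiv x (pderiv x p))
      = ∑ τ ∈ p.support, (τ x * (τ x - 1)) * (multiFactorial τ * coeff τ p ^ 2) := by
  have h : X x * (X x * pderiv x (pderiv x p))
      = X x * pderiv x (X x * pderiv x p) - X x * pderiv x p := by
    rw [pderiv_mul, pderiv_X_self]
    ring
  rw [← fischer_mul_X, ← fischer_mul_X, h, fischer_eq_sum (Finset.Subset.refl _)]
  refine Finset.sum_congr rfl fun τ _ => ?_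
  rw [coeff_sub, coeff_X_mul_pderiv, coeff_X_mul_pderiv]
  ring

/-- Bessel's inequality for the Fischer inner product. -/
lemma fischer_bessel {κ : Type*} [DecidableEq κ] (F : Finset κ) (φ : κ → MvPolynomial ι ℝ)
    (hφ : ∀ i j, fischer ι (φ i) (φ j) = if i = j then 1 else 0) (p : MvPolynomial ι ℝ) :
    ∑ m ∈ F, fischer ι p (φ m) ^ 2 ≤ fischer ι p p := by
  have h := fischer_self_nonneg (p - ∑ m ∈ F, fischer ι p (φ m) • φ m)
  have h1 : fischer ι p (∑ m ∈ F, fischer ι p (φ m) • φ m) = ∑ m ∈ F, fischer ι p (φ m) ^ 2 := by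
    rw [map_sum]
    refine Finset.sum_congr rfl fun m _ => ?_
    rw [LinearMap.map_smul, smul_eq_mul, sq]
  have h2 : fischer ι (∑ m ∈ F, fischer ι p (φ m) • φ m) (∑ m ∈ F, fischer ι p (φ m) • φ m)
      = ∑ m ∈ F, fischer ι p (φ m) ^ 2 := by
    rw [fischer_sum_left]
    refine Finset.sum_congr rfl fun m hm => ?_
    rw [fischer_sum_right, Finset.sum_eq_single m]
    · simp [hφ, sq]
    · intro k _ hk
      simp [hφ, hk.symm]
    · exact fun h => absurd hm h
  rw [map_sub (fischer ι), LinearMap.sub_apply, map_sub, map_sub, h2,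
    fischer_comm (∑ m ∈ F, fischer ι p (φ m) • φ m) p, h1] at h
  linarith

end FockSpace

/-! ### Orthonormal modes and Wick's rule. -/

section Modes

open MvPolynomial

variable {ι J : Type*} [Fintype ι] [Fintype J]

/-- The linear form with the given coefficients: the creation operator of a mode. -/
def linForm (u : ι → ℝ) : MvPolynomial ι ℝ := ∑ x, C (u x) * X x

lemma pderiv_linForm (u : ι → ℝ) (x : ι) : pderiv x (linForm u) = C (u x) := by
  classical
  rw [linForm, map_sum, Finset.sum_eq_single x]
  · rw [pderiv_C_mul, pderiv_X_self, mul_one]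
  · intro y _ hy
    rw [pderiv_C_mul, pderiv_X_of_ne hy, mul_zero]
  · simp

/-- The change of variables that sends the variable `j` to the mode `u j`. -/
def modeMap (u : J → ι → ℝ) : MvPolynomial J ℝ →ₐ[ℝ] MvPolynomial ι ℝ :=
  aeval fun j => linForm (u j)

/-- The directional derivative. -/
def dirDeriv (a : ι → ℝ) (p : MvPolynomial ι ℝ) : MvPolynomial ι ℝ := ∑ j, a j • pderiv j p

lemma pderiv_modeMap (u : J → ι → ℝ) (x : ι) (p : MvPolynomial J ℝ) :
    pderiv x (modeMap u p) = modeMap u (dirDeriv (fun j => u j x) p) := by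
  classical
  induction p using MvPolynomial.induction_on with
  | C a => simp [modeMap, dirDeriv]
  | add p q hp hq =>
    rw [map_add, map_add, hp, hq, ← map_add]
    congr 1
    simp [dirDeriv, Finset.sum_add_distrib]
  | mul_X p k hp =>
    rw [map_mul, pderiv_mul, hp]
    have h1 : modeMap u (X k) = linForm (u k) := by simp [modeMap]
    have h2 : dirDeriv (fun j => u j x) (p * X k)
        = dirDeriv (fun j => u j x) p * X k + p * C (u k x) := by
      simp only [dirDeriv, pderiv_mul, smul_add, Finset.sum_add_distrib, Finset.sum_mul,
        smul_mul_assoc]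
      congr 1
      rw [Finset.sum_eq_single k]
      · rw [pderiv_X_self, mul_one, smul_eq_C_mul, mul_comm]
      · intro j _ hj
        rw [pderiv_X_of_ne hj.symm, mul_zero, smul_zero]
      · simp
    rw [h1, pderiv_linForm, h2, map_add, map_mul, map_mul, h1]
    congr 2
    simp [modeMap]

lemma fischer_linForm_mul (u : ι → ℝ) (p q : MvPolynomial ι ℝ) :
    fischer ι (linForm u * p) q = fischer ι p (dirDeriv u q) := by
  rw [linForm, Finset.sum_mul, map_sum, LinearMap.sum_apply, dirDeriv, map_sum]
  refine Finset.sum_congr rfl fun x _ => ?_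
  rw [mul_assoc, ← smul_eq_C_mul, LinearMap.map_smul, LinearMap.smul_apply, fischer_X_mul,
    LinearMap.map_smul]

/-- A family of orthonormal modes. -/
def IsModes [DecidableEq J] (u : J → ι → ℝ) : Prop :=
  ∀ j k, ∑ x, u j x * u k x = if j = k then 1 else 0

lemma multiFactorial_eq_mul_sub_single {m : J →₀ ℕ} {j : J} (h : m j ≠ 0) :
    multiFactorial m = m j * multiFactorial (m - Finsupp.single j 1) := by
  conv_lhs => rw [← Finsupp.sub_add_single_one_cancel h, multiFactorial_add_single]
  congr 1
  rw [Finsupp.tsub_apply, Finsupp.single_eq_same, Nat.cast_sub (Nat.one_le_iff_ne_zero.2 h)]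
  simp

variable [DecidableEq J]

lemma dirDeriv_modeMap {u : J → ι → ℝ} (hu : IsModes u) (j : J) (p : MvPolynomial J ℝ) :
    dirDeriv (u j) (modeMap u p) = modeMap u (pderiv j p) := by
  simp_rw [dirDeriv, pderiv_modeMap, dirDeriv, ← LinearMapClass.map_smul, ← map_sum,
    Finset.smul_sum, smul_smul]
  rw [Finset.sum_comm]
  simp_rw [← Finset.sum_smul, hu j]
  simp

/-- Second quantization of an isometry is an isometry. Moving a factor to the other side yields a
derivative along its mode, which `modeMap` intertwines with the partial derivative by
orthonormality; for constants, linear forms do not change the constant coefficient. -/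
lemma fischer_modeMap {u : J → ι → ℝ} (hu : IsModes u) (p q : MvPolynomial J ℝ) :
    fischer ι (modeMap u p) (modeMap u q) = fischer J p q := by
  induction p using MvPolynomial.induction_on generalizing q with
  | C a =>
    have h1 : modeMap u (C a) = monomial 0 a := by simp [modeMap]
    rw [h1, fischer_monomial, ← monomial_zero', fischer_monomial]
    have h2 : coeff 0 (modeMap u q) = coeff 0 q := by
      change constantCoeff _ = constantCoeff _
      have h3 : constantCoeff.comp (modeMap u).toRingHom = constantCoeff := by
        refine MvPolynomial.ringHom_ext (fun r => by simp [modeMap]) (fun j => ?_)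
        simp [linForm, modeMap]
      exact congrArg (fun f => f q) h3
    rw [h2]
    simp [multiFactorial]
  | add p₁ p₂ h₁ h₂ => rw [map_add, map_add, map_add, LinearMap.add_apply, LinearMap.add_apply, h₁, h₂]
  | mul_X p k hp =>
    have h1 : modeMap u (X k) = linForm (u k) := by simp [modeMap]
    rw [map_mul, h1, mul_comm, fischer_linForm_mul, dirDeriv_modeMap hu, hp, mul_comm p,
      fischer_X_mul]

lemma fischer_pderiv_monomial_self (m : J →₀ ℕ) (c : ℝ) (j : J) :
    fischer J (pderiv j (monomial m c)) (pderiv j (monomial m c))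
      = c ^ 2 * m j * multiFactorial m := by
  rw [pderiv_monomial, fischer_monomial, coeff_monomial, if_pos rfl]
  by_cases h : m j = 0
  · simp [h]
  · rw [multiFactorial_eq_mul_sub_single h]
    ring

lemma fischer_pderiv_monomial_of_ne (m : J →₀ ℕ) {j k : J} (hjk : j ≠ k) :
    fischer J (pderiv j (monomial m 1)) (pderiv k (monomial m 1)) = 0 := by
  rw [pderiv_monomial, pderiv_monomial, fischer_monomial, coeff_monomial]
  by_cases hj : m j = 0
  · simp [hj]
  rw [if_neg, mul_zero]
  intro h
  have h1 := DFunLike.congr_fun h j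
  simp only [Finsupp.tsub_apply, Finsupp.single_eq_same, Finsupp.single_eq_of_ne hjk] at h1
  omega

lemma fischer_dirDeriv_monomial (a : J → ℝ) (m : J →₀ ℕ) :
    fischer J (dirDeriv a (monomial m 1)) (dirDeriv a (monomial m 1))
      = (∑ j, a j ^ 2 * m j) * multiFactorial m := by
  rw [dirDeriv, fischer_sum_left, Finset.sum_mul]
  refine Finset.sum_congr rfl fun j _ => ?_
  rw [fischer_sum_right, Finset.sum_eq_single j]
  · rw [fischer_smul_left, fischer_smul_right, fischer_pderiv_monomial_self]
    ring
  · intro k _ hk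
    rw [fischer_smul_left, fischer_smul_right, fischer_pderiv_monomial_of_ne m hk.symm, mul_zero,
      mul_zero]
  · simp

lemma fischer_pderiv_pderiv_monomial_le (m : J →₀ ℕ) (j k : J) :
    fischer J (pderiv j (pderiv k (monomial m 1))) (pderiv j (pderiv k (monomial m 1)))
      ≤ m j * m k * multiFactorial m := by
  rw [pderiv_monomial (i := k), fischer_pderiv_monomial_self]
  by_cases hk : m k = 0
  · simp [hk]
  · rw [multiFactorial_eq_mul_sub_single hk]
    have h1 : (((m - Finsupp.single k 1 : J →₀ ℕ) j : ℕ) : ℝ) ≤ m j := by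
      exact_mod_cast Nat.sub_le _ _
    have h2 := multiFactorial_pos (m - Finsupp.single k 1)
    calc _ = (((m - Finsupp.single k 1 : J →₀ ℕ) j : ℕ) : ℝ)
          * ((m k : ℝ) ^ 2 * multiFactorial (m - Finsupp.single k 1)) := by ring
      _ ≤ m j * ((m k : ℝ) ^ 2 * multiFactorial (m - Finsupp.single k 1)) := by gcongr
      _ = _ := by ring

lemma fischer_pderiv_pderiv_monomial_eq_zero (m : J →₀ ℕ) {j k i l : J}
    (h1 : (i, l) ≠ (j, k)) (h2 : (i, l) ≠ (k, j)) :
    fischer J (pderiv j (pderiv k (monomial m 1))) (pderiv i (pderiv l (monomial m 1))) = 0 := by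
  simp only [pderiv_monomial]
  rw [fischer_monomial, coeff_monomial]
  split_ifs with h
  · by_contra hne
    have hk : m k ≠ 0 := by rintro h0; simp [h0] at hne
    have hl : m l ≠ 0 := by rintro h0; simp [h0] at hne
    have hj : (m - Finsupp.single k 1 : J →₀ ℕ) j ≠ 0 := by rintro h0; simp [h0] at hne
    have hi : (m - Finsupp.single l 1 : J →₀ ℕ) i ≠ 0 := by rintro h0; simp [h0] at hne
    have hm : ∀ t, (m - Finsupp.single l 1 - Finsupp.single i 1 : J →₀ ℕ) t
        = (m - Finsupp.single k 1 - Finsupp.single j 1 : J →₀ ℕ) t := fun t => by rw [h]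
    have e1 := hm i
    have e2 := hm l
    have e3 := hm j
    have e4 := hm k
    simp only [Finsupp.tsub_apply, Finsupp.single_apply, ne_eq, Prod.mk.injEq] at *
    grind
  · rw [mul_zero]

/-- Wick's rule: removing the modes `j, k` and removing `i, l` from a monomial give orthogonal
results unless the pairs agree up to order. The two orders produce the factor `2`. -/
lemma fischer_dirDeriv_dirDeriv_monomial_le (a : J → ℝ) (m : J →₀ ℕ) :
    fischer J (dirDeriv a (dirDeriv a (monomial m 1))) (dirDeriv a (dirDeriv a (monomial m 1)))
      ≤ 2 * (∑ j, a j ^ 2 * m j) ^ 2 * multiFactorial m := by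
  set f : J × J → MvPolynomial J ℝ := fun p => pderiv p.1 (pderiv p.2 (monomial m 1)) with hf
  have hexp : dirDeriv a (dirDeriv a (monomial m (1 : ℝ)))
      = ∑ p : J × J, (a p.1 * a p.2) • f p := by
    rw [Fintype.sum_prod_type]
    simp only [dirDeriv, map_sum, Finset.smul_sum, hf, Derivation.map_smul, smul_smul]
  have hle : ∀ p : J × J, (a p.1 * a p.2) ^ 2 * fischer J (f p) (f p)
      ≤ (a p.1 ^ 2 * m p.1) * (a p.2 ^ 2 * m p.2) * multiFactorial m := by
    intro p
    calc _ ≤ (a p.1 * a p.2) ^ 2 * (m p.1 * m p.2 * multiFactorial m) := by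
          gcongr
          exact fischer_pderiv_pderiv_monomial_le m p.1 p.2
      _ = _ := by ring
  have hswap : ∀ p : J × J, f p.swap = f p := by
    intro p
    simp only [hf, Prod.fst_swap, Prod.snd_swap]
    exact pderiv_comm _ _ _
  have hrow : ∀ p : J × J, ∑ q : J × J, (a p.1 * a p.2) * ((a q.1 * a q.2) * fischer J (f p) (f q))
      ≤ 2 * ((a p.1 * a p.2) ^ 2 * fischer J (f p) (f p)) := by
    intro p
    have h0 := fischer_self_nonneg (f p)
    rw [← Finset.sum_subset (Finset.subset_univ ({p, p.swap} : Finset (J × J)))]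
    · by_cases hp : p = p.swap
      · rw [← hp, Finset.pair_eq_singleton, Finset.sum_singleton]
        nlinarith [mul_nonneg (sq_nonneg (a p.1 * a p.2)) h0]
      · rw [Finset.sum_pair hp, hswap, Prod.fst_swap, Prod.snd_swap]
        apply le_of_eq
        ring
    · intro q _ hq
      simp only [Finset.mem_insert, Finset.mem_singleton, not_or] at hq
      rw [fischer_pderiv_pderiv_monomial_eq_zero m hq.1 hq.2, mul_zero, mul_zero]
  rw [hexp, fischer_sum_left]
  calc _ = ∑ p : J × J, ∑ q : J × J,
        (a p.1 * a p.2) * ((a q.1 * a q.2) * fischer J (f p) (f q)) := by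
        refine Finset.sum_congr rfl fun p _ => ?_
        rw [fischer_sum_right]
        simp_rw [fischer_smul_left, fischer_smul_right]
    _ ≤ ∑ p : J × J, 2 * ((a p.1 ^ 2 * m p.1) * (a p.2 ^ 2 * m p.2) * multiFactorial m) :=
        Finset.sum_le_sum fun p _ => (hrow p).trans (by linarith [hle p])
    _ = _ := by
        rw [sq, Finset.sum_mul_sum, ← Finset.sum_product', Finset.univ_product_univ,
          Finset.mul_sum, Finset.sum_mul]
        refine Finset.sum_congr rfl fun p _ => by ring

end Modes

end Heisenberg

namespace Heisenberg

open Matrix MvPolynomial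

/-! ### From bosons to spins. -/

section SpinVectors

/-- The squared norm of the spin state that corresponds to the state of `n` unnormalized bosons. -/
def spinWeight (N n : ℕ) : ℝ := (N.descFactorial n : ℝ) * n.factorial / (N : ℝ) ^ n

lemma spinWeight_nonneg (N n : ℕ) : 0 ≤ spinWeight N n := by
  rw [spinWeight]; positivity

lemma spinWeight_succ {N n : ℕ} (hn : n ≤ N) :
    spinWeight N (n + 1) = spinWeight N n * (((N : ℝ) - n) * (n + 1) / N) := by
  rw [spinWeight, spinWeight, Nat.descFactorial_succ, Nat.factorial_succ, pow_succ]
  push_cast [Nat.cast_sub hn]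
  rw [div_mul_div_comm]
  congr 1
  ring

lemma spinWeight_le {N : ℕ} (n : ℕ) : spinWeight N n ≤ n.factorial := by
  rw [spinWeight, mul_div_right_comm]
  have h1 : (N.descFactorial n : ℝ) ≤ (N : ℝ) ^ n := by exact_mod_cast Nat.descFactorial_le_pow N n
  exact mul_le_of_le_one_left (by positivity) (div_le_one_of_le₀ h1 (by positivity))

/-- There is equality for `n = 0, 1`, and for `n ≥ 2` the left side is not positive. This crude
bound is uniform in the spin and counts just the pairs of particles. -/
lemma le_spinWeight {N : ℕ} (hN : 1 ≤ N) (n : ℕ) :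
    (n.factorial : ℝ) * (1 - n * (n - 1) / 2) ≤ spinWeight N n := by
  have hN' : (N : ℝ) ≠ 0 := by positivity
  match n with
  | 0 => simp [spinWeight]
  | 1 => simp [spinWeight, hN']
  | n + 2 =>
    refine le_trans ?_ (spinWeight_nonneg N _)
    refine mul_nonpos_of_nonneg_of_nonpos (by positivity) ?_
    push_cast
    have : (0 : ℝ) ≤ n := Nat.cast_nonneg n
    nlinarith

variable {N L : ℕ}

/-- The occupation numbers of a configuration. -/
def occ (σ : Config N L) : Fin L →₀ ℕ := Finsupp.equivFunOnFinite.symm fun i => (σ i : ℕ)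

@[simp] lemma occ_apply (σ : Config N L) (x : Fin L) : occ σ x = σ x := rfl

lemma occ_injective : Function.Injective (occ : Config N L → _) := by
  intro σ τ h
  ext x
  exact DFunLike.congr_fun h x

lemma occ_update (σ : Config N L) (x : Fin L) (k : Fin (N + 1)) (hk : (k : ℕ) = (σ x : ℕ) + 1) :
    occ (Function.update σ x k) = occ σ + Finsupp.single x 1 := by
  ext y
  rw [Finsupp.add_apply, occ_apply, occ_apply]
  by_cases h : y = x
  · subst h; simp [hk]
  · rw [Function.update_of_ne h, Finsupp.single_eq_of_ne h, add_zero]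

/-- The norm of the image of a monomial in the spin space. -/
def spinNorm (N : ℕ) (τ : Fin L →₀ ℕ) : ℝ := ∏ x, Real.sqrt (spinWeight N (τ x))

lemma spinNorm_sq (τ : Fin L →₀ ℕ) : spinNorm N τ ^ 2 = ∏ x, spinWeight N (τ x) := by
  rw [spinNorm, ← Finset.prod_pow]
  exact Finset.prod_congr rfl fun x _ => Real.sq_sqrt (spinWeight_nonneg _ _)

lemma spinNorm_sq_le (τ : Fin L →₀ ℕ) : spinNorm N τ ^ 2 ≤ multiFactorial τ := by
  rw [spinNorm_sq]
  exact Finset.prod_le_prod (fun x _ => spinWeight_nonneg _ _) fun x _ => spinWeight_le _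

lemma one_sub_sum_le_prod {ι : Type*} (s : Finset ι) (f : ι → ℝ) (h0 : ∀ i ∈ s, 0 ≤ f i)
    (h1 : ∀ i ∈ s, f i ≤ 1) : 1 - ∑ i ∈ s, (1 - f i) ≤ ∏ i ∈ s, f i := by
  classical
  induction s using Finset.induction_on with
  | empty => simp
  | insert a s ha ih =>
    rw [Finset.sum_insert ha, Finset.prod_insert ha]
    have h2 := ih (fun i hi => h0 i (Finset.mem_insert_of_mem hi))
      (fun i hi => h1 i (Finset.mem_insert_of_mem hi))
    have h3 : ∏ i ∈ s, f i ≤ 1 := Finset.prod_le_one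
      (fun i hi => h0 i (Finset.mem_insert_of_mem hi))
      (fun i hi => h1 i (Finset.mem_insert_of_mem hi))
    have h4 := h0 a (Finset.mem_insert_self _ _)
    have h5 := h1 a (Finset.mem_insert_self _ _)
    nlinarith

lemma le_spinNorm_sq (hN : 1 ≤ N) (τ : Fin L →₀ ℕ) :
    multiFactorial τ * (1 - 1 / 2 * ∑ x, (τ x * (τ x - 1) : ℝ)) ≤ spinNorm N τ ^ 2 := by
  have hf : ∀ x, (0 : ℝ) < (τ x).factorial := fun x => by exact_mod_cast Nat.factorial_pos _
  have h1 : spinNorm N τ ^ 2 = multiFactorial τ * ∏ x, spinWeight N (τ x) / (τ x).factorial := by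
    rw [spinNorm_sq, multiFactorial, ← Finset.prod_mul_distrib]
    exact Finset.prod_congr rfl fun x _ => (mul_div_cancel₀ _ (hf x).ne').symm
  rw [h1]
  refine mul_le_mul_of_nonneg_left ?_ (multiFactorial_pos τ).le
  refine le_trans ?_ (one_sub_sum_le_prod _ _
    (fun x _ => div_nonneg (spinWeight_nonneg _ _) (hf x).le)
    (fun x _ => div_le_one_of_le₀ (spinWeight_le _) (hf x).le))
  rw [Finset.mul_sum]
  refine sub_le_sub_left (Finset.sum_le_sum fun x _ => ?_) _
  have h2 := le_spinWeight hN (τ x)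
  rw [← le_div_iff₀' (hf x)] at h2
  linarith

lemma spinNorm_add_single (τ : Fin L →₀ ℕ) (x : Fin L) (hx : τ x ≤ N) :
    spinNorm N (τ + Finsupp.single x 1)
      = spinNorm N τ * Real.sqrt (((N : ℝ) - τ x) * (τ x + 1) / N) := by
  rw [spinNorm, spinNorm, ← Finset.mul_prod_erase _ _ (Finset.mem_univ x),
    ← Finset.mul_prod_erase (a := x) _ (fun x => Real.sqrt (spinWeight N (τ x)))
      (Finset.mem_univ x)]
  rw [mul_right_comm]
  congr 1
  · rw [Finsupp.add_apply, Finsupp.single_eq_same, spinWeight_succ hx,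
      Real.sqrt_mul (spinWeight_nonneg _ _)]
  · refine Finset.prod_congr rfl fun y hy => ?_
    rw [Finsupp.add_apply, Finsupp.single_eq_of_ne (Finset.ne_of_mem_erase hy), add_zero]

/-- The spin state of a state in the Fock space, in the Dyson representation. -/
def spinVec (N : ℕ) (p : MvPolynomial (Fin L) ℝ) : Config N L → ℂ :=
  fun σ => ((spinNorm N (occ σ) * coeff (occ σ) p : ℝ) : ℂ)

lemma normSq_spinVec (p : MvPolynomial (Fin L) ℝ) :
    normSq (spinVec N p) = ∑ σ : Config N L, spinNorm N (occ σ) ^ 2 * coeff (occ σ) p ^ 2 := by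
  refine Finset.sum_congr rfl fun σ _ => ?_
  rw [spinVec, Complex.norm_real, Real.norm_eq_abs, sq_abs, mul_pow]

/-- The map is a contraction: each weight is at most the factorial in the Fischer product, and
monomials with more than `N` particles on a site are dropped. -/
lemma normSq_spinVec_le (p : MvPolynomial (Fin L) ℝ) :
    normSq (spinVec N p) ≤ fischer (Fin L) p p := by
  rw [normSq_spinVec, fischer_eq_sum
    (Finset.subset_union_left (s₂ := (Finset.univ : Finset (Config N L)).image occ))]
  calc _ ≤ ∑ σ : Config N L, multiFactorial (occ σ) * (coeff (occ σ) p * coeff (occ σ) p) := by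
        refine Finset.sum_le_sum fun σ _ => ?_
        rw [← sq]
        gcongr
        exact spinNorm_sq_le _
    _ = ∑ τ ∈ (Finset.univ : Finset (Config N L)).image occ,
          multiFactorial τ * (coeff τ p * coeff τ p) := by
        rw [Finset.sum_image fun σ _ τ _ h => occ_injective h]
    _ ≤ _ := Finset.sum_le_sum_of_subset_of_nonneg Finset.subset_union_right fun τ _ _ =>
        mul_nonneg (multiFactorial_pos τ).le (mul_self_nonneg _)

lemma spinNorm_eq_zero {τ : Fin L →₀ ℕ} {x : Fin L} (h : N < τ x) : spinNorm N τ = 0 := by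
  refine Finset.prod_eq_zero (Finset.mem_univ x) ?_
  rw [spinWeight, Nat.descFactorial_eq_zero_iff_lt.2 h]
  simp

/-- The norm is lost only through coinciding particles, so the loss is at most half the expected
number of ordered pairs on a common site. Occupations above `N` need no separate estimate, since
their weight vanishes and `le_spinNorm_sq` covers them. -/
lemma le_normSq_spinVec (hN : 1 ≤ N) (p : MvPolynomial (Fin L) ℝ) :
    fischer (Fin L) p p
      - 1 / 2 * ∑ x, fischer (Fin L) (pderiv x (pderiv x p)) (pderiv x (pderiv x p))
      ≤ normSq (spinVec N p) := by
  simp_rw [fischer_pderiv_pderiv]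
  rw [fischer_eq_sum (Finset.Subset.refl _), Finset.sum_comm, Finset.mul_sum,
    ← Finset.sum_sub_distrib]
  calc _ ≤ ∑ τ ∈ p.support, spinNorm N τ ^ 2 * coeff τ p ^ 2 := by
        refine Finset.sum_le_sum fun τ _ => ?_
        have h := mul_le_mul_of_nonneg_right (le_spinNorm_sq hN τ) (sq_nonneg (coeff τ p))
        refine le_trans (le_of_eq ?_) h
        rw [← Finset.sum_mul]
        ring
    _ = ∑ τ ∈ p.support with τ ∈ (Finset.univ : Finset (Config N L)).image occ,
          spinNorm N τ ^ 2 * coeff τ p ^ 2 := by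
        symm
        refine Finset.sum_filter_of_ne fun τ _ hne => ?_
        have h : ∀ x, τ x < N + 1 := by
          intro x
          by_contra hx
          apply hne
          rw [spinNorm_eq_zero (x := x) (by omega)]
          ring
        rw [Finset.mem_image]
        exact ⟨fun x => ⟨τ x, h x⟩, Finset.mem_univ _, by ext x; simp⟩
    _ ≤ ∑ τ ∈ (Finset.univ : Finset (Config N L)).image occ,
          spinNorm N τ ^ 2 * coeff τ p ^ 2 := by
        refine Finset.sum_le_sum_of_subset_of_nonneg (fun τ hτ => (Finset.mem_filter.1 hτ).2)
          fun τ _ _ => by positivity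
    _ = _ := by
        rw [Finset.sum_image fun σ _ τ _ h => occ_injective h, normSq_spinVec]

/-- The adjoint of `spinVec`. -/
def spinVecAdj (f : Config N L → ℝ) : MvPolynomial (Fin L) ℝ :=
  ∑ σ, monomial (occ σ) (f σ * spinNorm N (occ σ) / multiFactorial (occ σ))

lemma fischer_spinVecAdj (f : Config N L → ℝ) (p : MvPolynomial (Fin L) ℝ) :
    fischer (Fin L) (spinVecAdj f) p = ∑ σ, f σ * (spinNorm N (occ σ) * coeff (occ σ) p) := by
  rw [spinVecAdj, fischer_sum_left]
  refine Finset.sum_congr rfl fun σ _ => ?_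
  rw [fischer_monomial, div_mul_cancel₀ _ (multiFactorial_pos _).ne', mul_assoc]

lemma fischer_spinVecAdj_self_le (f : Config N L → ℝ) :
    fischer (Fin L) (spinVecAdj f) (spinVecAdj f) ≤ ∑ σ, f σ ^ 2 := by
  rw [fischer_spinVecAdj]
  refine Finset.sum_le_sum fun σ _ => ?_
  have h : coeff (occ σ) (spinVecAdj f)
      = f σ * spinNorm N (occ σ) / multiFactorial (occ σ) := by
    rw [spinVecAdj, coeff_sum, Finset.sum_eq_single σ]
    · rw [coeff_monomial, if_pos rfl]
    · intro τ _ hτ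
      rw [coeff_monomial, if_neg fun h => hτ (occ_injective h)]
    · simp
  rw [h]
  have h1 := spinNorm_sq_le (N := N) (occ σ)
  have h2 := multiFactorial_pos (occ σ)
  calc _ = f σ ^ 2 * (spinNorm N (occ σ) ^ 2 / multiFactorial (occ σ)) := by ring
    _ ≤ f σ ^ 2 * 1 := by gcongr; exact div_le_one_of_le₀ h1 h2.le
    _ = _ := mul_one _

/-- The adjoint of `spinVec` is a contraction too, so Bessel's inequality in the Fock space, applied
to the image of `ψ` under the adjoint, passes to the spin space. The polynomials are real, hence the
split of `ψ` into real and imaginary parts. -/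
lemma isBessel_spinVec {κ : Type*} [DecidableEq κ] (F : Finset κ)
    (φ : κ → MvPolynomial (Fin L) ℝ)
    (hφ : ∀ i j, fischer (Fin L) (φ i) (φ j) = if i = j then 1 else 0) :
    IsBessel F fun m => spinVec N (φ m) := by
  intro ψ
  have h : ∀ p : MvPolynomial (Fin L) ℝ, ‖star ψ ⬝ᵥ spinVec N p‖ ^ 2
      = fischer (Fin L) (spinVecAdj fun σ => (ψ σ).re) p ^ 2
        + fischer (Fin L) (spinVecAdj fun σ => (ψ σ).im) p ^ 2 := by
    intro p
    rw [← Complex.normSq_eq_norm_sq, Complex.normSq_apply, fischer_spinVecAdj, fischer_spinVecAdj,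
      dotProduct, Complex.re_sum, Complex.im_sum]
    simp only [Pi.star_apply, spinVec, Complex.star_def, Complex.re_mul_ofReal,
      Complex.im_mul_ofReal, Complex.conj_re, Complex.conj_im, neg_mul, Finset.sum_neg_distrib]
    ring
  simp_rw [h]
  rw [Finset.sum_add_distrib]
  have h1 := (fischer_bessel F φ hφ (spinVecAdj fun σ => (ψ σ).re)).trans
    (fischer_spinVecAdj_self_le _)
  have h2 := (fischer_bessel F φ hφ (spinVecAdj fun σ => (ψ σ).im)).trans
    (fischer_spinVecAdj_self_le _)
  refine (add_le_add h1 h2).trans (le_of_eq ?_)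
  rw [← Finset.sum_add_distrib, normSq]
  refine Finset.sum_congr rfl fun σ _ => ?_
  rw [← Complex.normSq_eq_norm_sq, Complex.normSq_apply]
  ring

/-- The weights satisfy `spinWeight (n + 1) = spinWeight n * (n + 1) (N - n) / N`, so the spin
annihilator is a derivative up to a factor depending only on the occupation of `x`. For a full site
both sides vanish. -/
lemma siteOp_annih_spinVec (hN : 1 ≤ N) (x : Fin L) (p : MvPolynomial (Fin L) ℝ)
    (σ : Config N L) : (siteOp x (annih N) *ᵥ spinVec N p) σ
      = ((Real.sqrt (((N : ℝ) - (σ x : ℕ)) / N) * (spinNorm N (occ σ) * coeff (occ σ) (pderiv x p))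
        : ℝ) : ℂ) := by
  rw [siteOp_mulVec]
  have hx := Nat.lt_succ_iff.1 (σ x).2
  rcases hx.lt_or_eq with hlt | heq
  · rw [Finset.sum_eq_single (⟨(σ x : ℕ) + 1, by omega⟩ : Fin (N + 1))]
    · rw [annih, if_pos rfl, spinVec, ← Complex.ofReal_mul, occ_update _ _ _ rfl,
        spinNorm_add_single _ _ hx, coeff_pderiv, occ_apply]
      congr 1
      have hxN := cast_le_of_fin (σ x)
      have h1 : (0 : ℝ) ≤ (σ x : ℕ) + 1 := by positivity
      have h2 : Real.sqrt (((N : ℝ) - (σ x : ℕ)) * ((σ x : ℕ) + 1) / N)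
          = Real.sqrt (((N : ℝ) - (σ x : ℕ)) / N) * Real.sqrt ((σ x : ℕ) + 1) := by
        rw [mul_div_right_comm, Real.sqrt_mul (div_nonneg (by linarith) (by positivity))]
      rw [h2]
      have h3 := Real.mul_self_sqrt h1
      linear_combination (Real.sqrt (((N : ℝ) - (σ x : ℕ)) / N) * spinNorm N (occ σ)
        * coeff (occ σ + Finsupp.single x 1) p) * h3
    · intro k _ hk
      rw [annih, if_neg, zero_mul]
      exact fun h => hk (Fin.ext h)
    · simp
  · rw [Finset.sum_eq_zero]
    · rw [heq]; simp
    · intro k _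
      rw [annih, if_neg, zero_mul]
      omega

/-- This is what the weights are chosen for: together with the `hole` operators, both terms of the
root carry the same factor, symmetric in `x` and `y`, and a plain difference of derivatives remains.
-/
lemma bondRoot_spinVec (hN : 1 ≤ N) {x y : Fin L} (hxy : x ≠ y) (p : MvPolynomial (Fin L) ℝ)
    (σ : Config N L) : (bondRoot N x y *ᵥ spinVec N p) σ
      = ((Real.sqrt ((N : ℝ) - (σ y : ℕ)) * Real.sqrt (((N : ℝ) - (σ x : ℕ)) / N)
        * (spinNorm N (occ σ) * coeff (occ σ) (pderiv x p - pderiv y p)) : ℝ) : ℂ) := by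
  have h : ∀ (z : Fin L) (v : Config N L → ℂ), (siteOp z (hole N) *ᵥ v) σ
      = ((Real.sqrt ((N : ℝ) - (σ z : ℕ)) : ℝ) : ℂ) * v σ := by
    intro z v
    rw [hole, siteOp_diagonal, mulVec_diagonal]
  rw [bondRoot, sub_mulVec, siteOp_comm hxy, ← mulVec_mulVec, ← mulVec_mulVec, Pi.sub_apply, h, h,
    siteOp_annih_spinVec hN, siteOp_annih_spinVec hN, coeff_sub, ← Complex.ofReal_mul,
    ← Complex.ofReal_mul, ← Complex.ofReal_sub]
  congr 1
  have hx := cast_le_of_fin (σ x)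
  have hy := cast_le_of_fin (σ y)
  rw [Real.sqrt_div (by linarith), Real.sqrt_div (by linarith)]
  ring

/-- The common factor squared is `(N - n_x) (N - n_y) / N ≤ N`, and `spinVec` is a contraction: the
spin interaction does not raise the energy above that of free bosons. -/
lemma quadForm_bondOp_spinVec_le (hN : 1 ≤ N) {x y : Fin L} (hxy : x ≠ y)
    (p : MvPolynomial (Fin L) ℝ) : quadForm (bondOp N x y) (spinVec N p)
      ≤ spin N * fischer (Fin L) (pderiv x p - pderiv y p) (pderiv x p - pderiv y p) := by
  have hN' : (0 : ℝ) < N := by positivity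
  have h1 : normSq (bondRoot N x y *ᵥ spinVec N p)
      ≤ N * normSq (spinVec N (pderiv x p - pderiv y p)) := by
    rw [normSq_spinVec, normSq, Finset.mul_sum]
    refine Finset.sum_le_sum fun σ _ => ?_
    have hx := cast_le_of_fin (σ x)
    have hy := cast_le_of_fin (σ y)
    have hx0 : (0 : ℝ) ≤ (σ x : ℕ) := Nat.cast_nonneg _
    have hy0 : (0 : ℝ) ≤ (σ y : ℕ) := Nat.cast_nonneg _
    rw [bondRoot_spinVec hN hxy, Complex.norm_real, Real.norm_eq_abs, sq_abs, mul_pow, mul_pow,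
      mul_pow, Real.sq_sqrt (by linarith), Real.sq_sqrt (div_nonneg (by linarith) hN'.le)]
    refine mul_le_mul_of_nonneg_right ?_ (by positivity)
    calc _ ≤ (N : ℝ) * 1 := by
          refine mul_le_mul (by linarith) (div_le_one_of_le₀ (by linarith) hN'.le)
            (div_nonneg (by linarith) hN'.le) hN'.le
      _ = _ := mul_one _
  rw [quadForm_bondOp N hxy, spin]
  have h2 := normSq_spinVec_le (N := N) (pderiv x p - pderiv y p)
  nlinarith

end SpinVectors

/-! ### Energy and norm of the trial states. -/

section TrialStates

variable {N L : ℕ} {J : Type*} [Fintype J]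

/-- The normalized Fock state with the given occupation numbers of the modes. -/
def fockState (u : J → Fin L → ℝ) (m : J →₀ ℕ) : MvPolynomial (Fin L) ℝ :=
  (Real.sqrt (multiFactorial m))⁻¹ • modeMap u (monomial m 1)

/-- The particle density of a Fock state. -/
def modeDensity (u : J → Fin L → ℝ) (m : J →₀ ℕ) (x : Fin L) : ℝ := ∑ j, u j x ^ 2 * m j

lemma inv_sqrt_sq (m : J →₀ ℕ) :
    (Real.sqrt (multiFactorial m))⁻¹ * (Real.sqrt (multiFactorial m))⁻¹ * multiFactorial m = 1 := by
  rw [← mul_inv, Real.mul_self_sqrt (multiFactorial_pos m).le,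
    inv_mul_cancel₀ (multiFactorial_pos m).ne']

lemma pderiv_fockState (u : J → Fin L → ℝ) (m : J →₀ ℕ) (x : Fin L) :
    pderiv x (fockState u m) = (Real.sqrt (multiFactorial m))⁻¹ •
      modeMap u (dirDeriv (fun j => u j x) (monomial m 1)) := by
  rw [fockState, Derivation.map_smul, pderiv_modeMap]

/-- If all modes vanish at `x`, the polynomial does not contain the variable `X x`. -/
lemma occupied_fockState {u : J → Fin L → ℝ} (m : J →₀ ℕ) {x : Fin L} (hx : ∀ j, u j x = 0) :
    occupied N x (spinVec N (fockState u m)) = 0 := by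
  have h : pderiv x (fockState u m) = 0 := by
    rw [pderiv_fockState]
    simp [dirDeriv, hx]
  refine Finset.sum_eq_zero fun σ _ => ?_
  split_ifs with h0
  · rw [zero_mul]
  · have h1 := coeff_X_mul_pderiv x (fockState u m) (occ σ)
    rw [h, mul_zero, coeff_zero, occ_apply] at h1
    have h2 : ((σ x : ℕ) : ℝ) ≠ 0 := by
      exact Nat.cast_ne_zero.2 fun h => h0 (Fin.ext h)
    have h3 := (mul_eq_zero.1 h1.symm).resolve_left h2
    simp [spinVec, h3]

variable [DecidableEq J]

lemma fischer_fockState {u : J → Fin L → ℝ} (hu : IsModes u) (m m' : J →₀ ℕ) :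
    fischer (Fin L) (fockState u m) (fockState u m') = if m = m' then 1 else 0 := by
  rw [fockState, fockState, fischer_smul_left, fischer_smul_right, fischer_modeMap hu,
    fischer_monomial, coeff_monomial]
  by_cases h : m = m'
  · subst h
    rw [if_pos rfl]
    linear_combination inv_sqrt_sq m
  · rw [if_neg h, if_neg fun h' => h h'.symm]
    ring

lemma quadForm_bondOp_fockState_le (hN : 1 ≤ N) {u : J → Fin L → ℝ} (hu : IsModes u)
    (m : J →₀ ℕ) {x y : Fin L} (hxy : x ≠ y) :
    quadForm (bondOp N x y) (spinVec N (fockState u m))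
      ≤ spin N * ∑ j, (u j x - u j y) ^ 2 * m j := by
  refine (quadForm_bondOp_spinVec_le hN hxy _).trans (le_of_eq ?_)
  have h : pderiv x (fockState u m) - pderiv y (fockState u m)
      = (Real.sqrt (multiFactorial m))⁻¹ •
        modeMap u (dirDeriv (fun j => u j x - u j y) (monomial m 1)) := by
    rw [pderiv_fockState, pderiv_fockState, ← smul_sub, ← map_sub]
    congr 2
    simp_rw [dirDeriv, sub_smul, Finset.sum_sub_distrib]
  rw [h, fischer_smul_left, fischer_smul_right, fischer_modeMap hu, fischer_dirDeriv_monomial]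
  linear_combination (spin N * ∑ j, (u j x - u j y) ^ 2 * m j) * inv_sqrt_sq m

/-- By Wick's rule the expected number of ordered pairs at `x` is at most twice the squared density;
the `2` cancels the `1 / 2` of `le_normSq_spinVec`. -/
lemma le_normSq_fockState (hN : 1 ≤ N) {u : J → Fin L → ℝ} (hu : IsModes u) (m : J →₀ ℕ) :
    1 - ∑ x, modeDensity u m x ^ 2 ≤ normSq (spinVec N (fockState u m)) := by
  refine le_trans ?_ (le_normSq_spinVec hN _)
  rw [fischer_fockState hu, if_pos rfl, Finset.mul_sum]
  refine sub_le_sub_left (Finset.sum_le_sum fun x _ => ?_) _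
  rw [pderiv_fockState, Derivation.map_smul, pderiv_modeMap, fischer_smul_left, fischer_smul_right,
    fischer_modeMap hu]
  have h1 := fischer_dirDeriv_dirDeriv_monomial_le (fun j => u j x) m
  have h2 : 0 ≤ (Real.sqrt (multiFactorial m))⁻¹ * (Real.sqrt (multiFactorial m))⁻¹ := by positivity
  have h3 := mul_le_mul_of_nonneg_left h1 h2
  have h4 := inv_sqrt_sq m
  rw [modeDensity]
  calc _ ≤ 1 / 2 * ((Real.sqrt (multiFactorial m))⁻¹ * (Real.sqrt (multiFactorial m))⁻¹
        * (2 * (∑ j, u j x ^ 2 * m j) ^ 2 * multiFactorial m)) := by linarith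
    _ = _ := by linear_combination ((∑ j, u j x ^ 2 * m j) ^ 2) * h4

end TrialStates

end Heisenberg

namespace Heisenberg

/-! ### Dirichlet sine modes. -/

section Sine

open Real

lemma two_mul_sin_half_mul_sum_cos (α : ℝ) (n : ℕ) :
    2 * sin (α / 2) * ∑ x ∈ Finset.range n, cos (x * α) = sin ((n - 1 / 2) * α) + sin (α / 2) := by
  induction n with
  | zero =>
    rw [Finset.range_zero, Finset.sum_empty, mul_zero, Nat.cast_zero,
      show ((0 : ℝ) - 1 / 2) * α = -(α / 2) by ring, sin_neg, neg_add_cancel]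
  | succ n ih =>
    rw [Finset.sum_range_succ, mul_add, ih]
    have h1 := sin_sub_sin ((n + 1 / 2) * α) ((n - 1 / 2) * α)
    rw [show ((n + 1 / 2) * α - (n - 1 / 2) * α) / 2 = α / 2 by ring,
      show ((n + 1 / 2) * α + (n - 1 / 2) * α) / 2 = n * α by ring] at h1
    push_cast
    rw [show (n + 1 - 1 / 2 : ℝ) * α = (n + 1 / 2) * α by ring]
    linarith

lemma two_mul_sin_mul_sum_cos_odd (θ : ℝ) (n : ℕ) :
    2 * sin θ * ∑ x ∈ Finset.range n, cos ((2 * x + 1) * θ) = sin (2 * n * θ) := by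
  induction n with
  | zero => simp
  | succ n ih =>
    rw [Finset.sum_range_succ, mul_add, ih]
    have h1 := sin_sub_sin (2 * (n + 1) * θ) (2 * n * θ)
    rw [show (2 * (n + 1) * θ - 2 * n * θ) / 2 = θ by ring,
      show (2 * (n + 1) * θ + 2 * n * θ) / 2 = (2 * n + 1) * θ by ring] at h1
    push_cast
    linarith

/-- The value depends only on the parity of `k`. Orthogonality of the sines follows, as `j - k` and
`j + k + 2` have equal parity. -/
lemma sum_cos_eq {n : ℕ} (hn : 0 < n) (k : ℤ) (h0 : k ≠ 0) (hk : |k| < 2 * n) :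
    ∑ x ∈ Finset.range n, cos (x * (π * k / n)) = (1 - cos (k * π)) / 2 := by
  have hn' : (0 : ℝ) < n := by exact_mod_cast hn
  have h := two_mul_sin_half_mul_sum_cos (π * k / n) n
  have hs : sin (π * k / n / 2) ≠ 0 := by
    have hk' : |(k : ℝ)| < 2 * n := by exact_mod_cast hk
    have h0' : (k : ℝ) ≠ 0 := by exact_mod_cast h0
    rw [abs_lt] at hk'
    rw [Ne, sin_eq_zero_iff_of_lt_of_lt]
    · have := pi_pos
      positivity
    · rw [div_div, lt_div_iff₀ (by positivity)]
      nlinarith [pi_pos]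
    · rw [div_div, div_lt_iff₀ (by positivity)]
      nlinarith [pi_pos]
  have h2 : ((n : ℝ) - 1 / 2) * (π * k / n) = k * π - π * k / n / 2 := by
    field_simp
  rw [h2, sin_sub, sin_int_mul_pi] at h
  have h3 : 2 * sin (π * k / n / 2) * (∑ x ∈ Finset.range n, cos (x * (π * k / n))
      - (1 - cos (k * π)) / 2) = 0 := by linear_combination h
  rcases mul_eq_zero.1 h3 with h4 | h4
  · exact absurd h4 (by simpa using hs)
  · linarith

/-- The Dirichlet sine modes of a block with sites `0, …, n`. -/
def sineMode (n : ℕ) (j : Fin (n - 1)) (x : Fin (n + 1)) : ℝ :=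
  √(2 / n) * sin (π * (j + 1 : ℕ) / n * x)

lemma sineMode_zero (n : ℕ) (j : Fin (n - 1)) : sineMode n j 0 = 0 := by
  simp [sineMode]

lemma sineMode_last (n : ℕ) (j : Fin (n - 1)) : sineMode n j (Fin.last n) = 0 := by
  have hj := j.2
  have hn : (n : ℝ) ≠ 0 := by
    have : n ≠ 0 := by omega
    exact_mod_cast this
  rw [sineMode, Fin.val_last, div_mul_cancel₀ _ hn, mul_comm π, sin_nat_mul_pi, mul_zero]

lemma isModes_sineMode (n : ℕ) : IsModes (sineMode n) := by
  intro j k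
  have hj := j.2
  have hk := k.2
  have hn : 0 < n := by omega
  have hn' : (0 : ℝ) < n := by exact_mod_cast hn
  rw [Fin.sum_univ_castSucc, sineMode_last, zero_mul, add_zero]
  have h1 : ∀ x : Fin n, sineMode n j x.castSucc * sineMode n k x.castSucc
      = (1 / n) * (cos (x * (π * ((j : ℤ) - (k : ℤ) : ℤ) / n))
        - cos (x * (π * ((j : ℤ) + (k : ℤ) + 2 : ℤ) / n))) := by
    intro x
    rw [sineMode, sineMode, Fin.val_castSucc]
    have h2 := cos_sub_cos (x * (π * ((j : ℤ) - (k : ℤ) : ℤ) / n))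
      (x * (π * ((j : ℤ) + (k : ℤ) + 2 : ℤ) / n))
    have e1 : (x * (π * ((j : ℤ) - (k : ℤ) : ℤ) / n) + x * (π * ((j : ℤ) + (k : ℤ) + 2 : ℤ) / n)) / 2
        = π * ((j : ℕ) + 1 : ℕ) / n * (x : ℕ) := by push_cast; ring
    have e2 : (x * (π * ((j : ℤ) - (k : ℤ) : ℤ) / n) - x * (π * ((j : ℤ) + (k : ℤ) + 2 : ℤ) / n)) / 2
        = -(π * ((k : ℕ) + 1 : ℕ) / n * (x : ℕ)) := by push_cast; ring
    rw [e1, e2, sin_neg] at h2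
    rw [h2]
    have h3 : √(2 / (n : ℝ)) * √(2 / n) = 2 / n := mul_self_sqrt (by positivity)
    linear_combination (sin (π * ((j : ℕ) + 1 : ℕ) / n * (x : ℕ))
      * sin (π * ((k : ℕ) + 1 : ℕ) / n * (x : ℕ))) * h3
  simp_rw [h1]
  rw [← Finset.mul_sum, Finset.sum_sub_distrib,
    Fin.sum_univ_eq_sum_range (fun x : ℕ => cos (x * (π * ((j : ℤ) - (k : ℤ) : ℤ) / n))),
    Fin.sum_univ_eq_sum_range (fun x : ℕ => cos (x * (π * ((j : ℤ) + (k : ℤ) + 2 : ℤ) / n))),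
    sum_cos_eq hn ((j : ℤ) + (k : ℤ) + 2) (by omega) (by rw [abs_lt]; omega)]
  by_cases h : j = k
  · subst h
    rw [if_pos rfl, sub_self]
    have h4 : ((((j : ℕ) : ℤ) + ((j : ℕ) : ℤ) + 2 : ℤ) : ℝ) * π = ((j : ℕ) + 1 : ℕ) * (2 * π) := by
      push_cast; ring
    rw [h4, cos_nat_mul_two_pi]
    simp [hn'.ne']
  · have hne : (j : ℕ) ≠ k := fun h' => h (Fin.ext h')
    rw [if_neg h, sum_cos_eq hn ((j : ℤ) - (k : ℤ)) (by omega) (by rw [abs_lt]; omega)]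
    have h4 : ((((j : ℕ) : ℤ) + ((k : ℕ) : ℤ) + 2 : ℤ) : ℝ) * π
        = ((((j : ℕ) : ℤ) - ((k : ℕ) : ℤ) : ℤ) : ℝ) * π + ((k : ℕ) + 1 : ℕ) * (2 * π) := by
      push_cast; ring
    rw [h4, cos_add_nat_mul_two_pi, sub_self, mul_zero]

/-- The squared difference is constant in `x` up to a cosine at odd multiples of `θ`. These cosines
sum to zero because `sin (2 n θ) = 0` while `sin θ ≠ 0` for `0 < θ < π`. -/
lemma sum_sineMode_sub_sq (n : ℕ) (j : Fin (n - 1)) :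
    ∑ x : Fin n, (sineMode n j x.castSucc - sineMode n j x.succ) ^ 2
      = 4 * sin (π * (j + 1 : ℕ) / n / 2) ^ 2 := by
  have hj := j.2
  have hn : 0 < n := by omega
  have hn' : (0 : ℝ) < n := by exact_mod_cast hn
  set θ : ℝ := π * (j + 1 : ℕ) / n with hθ
  have h1 : ∀ x : Fin n, (sineMode n j x.castSucc - sineMode n j x.succ) ^ 2
      = 4 * sin (θ / 2) ^ 2 * (1 / n) * (1 + cos ((2 * (x : ℕ) + 1) * θ)) := by
    intro x
    rw [sineMode, sineMode, Fin.val_castSucc, Fin.val_succ, ← hθ, ← mul_sub, mul_pow,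
      sq_sqrt (by positivity), sin_sub_sin]
    have e1 : (θ * (x : ℕ) - θ * ((x : ℕ) + 1 : ℕ)) / 2 = -(θ / 2) := by push_cast; ring
    have e2 : (θ * (x : ℕ) + θ * ((x : ℕ) + 1 : ℕ)) / 2 = (2 * (x : ℕ) + 1) * θ / 2 := by
      push_cast; ring
    have h3 := cos_sq ((2 * (x : ℕ) + 1) * θ / 2)
    rw [show 2 * ((2 * (x : ℕ) + 1) * θ / 2) = (2 * (x : ℕ) + 1) * θ by ring] at h3
    rw [e1, e2, sin_neg]
    linear_combination (8 / n * sin (θ / 2) ^ 2) * h3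
  simp_rw [h1]
  rw [← Finset.mul_sum, Finset.sum_add_distrib,
    Fin.sum_univ_eq_sum_range (fun x : ℕ => cos ((2 * (x : ℕ) + 1) * θ))]
  have h4 := two_mul_sin_mul_sum_cos_odd θ n
  have h5 : (2 : ℝ) * n * θ = ((j : ℕ) + 1 : ℕ) * (2 * π) := by
    rw [hθ]; field_simp
  have hs : sin θ ≠ 0 := by
    apply ne_of_gt
    apply sin_pos_of_pos_of_lt_pi
    · have := pi_pos
      positivity
    · rw [hθ, div_lt_iff₀ hn']
      have : (((j : ℕ) + 1 : ℕ) : ℝ) < n := by exact_mod_cast (by omega)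
      have := pi_pos
      gcongr
  rw [h5, ← sub_zero (_ * (2 * π)), sin_nat_mul_two_pi_sub, sin_zero, neg_zero] at h4
  have h6 := (mul_eq_zero.1 h4).resolve_left (by simpa using hs)
  rw [h6]
  simp
  field_simp

end Sine

/-! ### The partition function of one block. -/

section Block

/-- The energy of a sine mode. -/
def modeEnergy (N n : ℕ) (j : Fin (n - 1)) : ℝ :=
  spin N * (4 * Real.sin (Real.pi * (j + 1 : ℕ) / n / 2) ^ 2)

lemma modeEnergy_nonneg (N n : ℕ) (j : Fin (n - 1)) : 0 ≤ modeEnergy N n j := by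
  rw [modeEnergy, spin]; positivity

lemma quadForm_dirichletHamiltonian_sine_le {N : ℕ} (hN : 1 ≤ N) {n : ℕ}
    (m : Fin (n - 1) →₀ ℕ) :
    quadForm (dirichletHamiltonian N (n + 1)) (spinVec N (fockState (sineMode n) m))
      ≤ ∑ j, modeEnergy N n j * m j := by
  set v := spinVec N (fockState (sineMode n) m)
  rw [quadForm_dirichletHamiltonian]
  have h1 : ∑ x : Fin (n + 1), (N : ℝ) ^ 2 * boundaryWeight x * occupied N x v = 0 := by
    refine Finset.sum_eq_zero fun x _ => ?_
    by_cases h0 : (x : ℕ) = 0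
    · rw [occupied_fockState m, mul_zero]
      intro j
      rw [show x = 0 from Fin.ext h0]
      exact sineMode_zero n j
    by_cases hl : (x : ℕ) + 1 = n + 1
    · rw [occupied_fockState m, mul_zero]
      intro j
      rw [show x = Fin.last n from Fin.ext (by simpa using hl)]
      exact sineMode_last n j
    · rw [boundaryWeight, if_neg h0, if_neg hl]
      ring
  have h2 : (∑ x : Fin (n + 1), ∑ y : Fin (n + 1), if (x : ℕ) + 1 = (y : ℕ) then
      quadForm (bondOp N x y) v else 0)
      = ∑ x : Fin n, quadForm (bondOp N x.castSucc x.succ) v := by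
    rw [Fin.sum_univ_castSucc, Finset.sum_eq_zero (f := fun y : Fin (n + 1) =>
      if ((Fin.last n : Fin (n + 1)) : ℕ) + 1 = (y : ℕ) then
        quadForm (bondOp N (Fin.last n) y) v else 0), add_zero]
    · refine Finset.sum_congr rfl fun x _ => ?_
      rw [Finset.sum_eq_single x.succ, if_pos (by simp)]
      · intro y _ hy
        rw [if_neg]
        intro h
        exact hy (Fin.ext (by simpa using h.symm))
      · simp
    · intro y _
      rw [if_neg]
      simp only [Fin.val_last]; omega
  rw [h1, h2, add_zero]
  calc _ ≤ ∑ x : Fin n, spin N *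
        ∑ j, (sineMode n j x.castSucc - sineMode n j x.succ) ^ 2 * m j := by
        refine Finset.sum_le_sum fun x _ => ?_
        exact quadForm_bondOp_fockState_le hN (isModes_sineMode n) m (Fin.castSucc_lt_succ).ne
    _ = _ := by
        rw [← Finset.mul_sum, Finset.sum_comm, Finset.mul_sum]
        refine Finset.sum_congr rfl fun j _ => ?_
        rw [← Finset.sum_mul, sum_sineMode_sub_sq, modeEnergy]
        ring

/-- Each mode has density at most `2 / n` at every site. The site `0` carries no density, so only
`n` of the `n + 1` sites count. -/
lemma le_normSq_sine {N : ℕ} (hN : 1 ≤ N) {n : ℕ} (hn : 0 < n) (m : Fin (n - 1) →₀ ℕ) :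
    1 - 4 * (∑ j, (m j : ℝ)) ^ 2 / n ≤ normSq (spinVec N (fockState (sineMode n) m)) := by
  have hn' : (0 : ℝ) < n := by exact_mod_cast hn
  refine le_trans ?_ (le_normSq_fockState hN (isModes_sineMode n) m)
  refine sub_le_sub_left ?_ _
  have h0 : modeDensity (sineMode n) m 0 = 0 := by
    rw [modeDensity]
    simp [sineMode_zero]
  rw [Fin.sum_univ_succ, h0]
  have h1 : ∀ x, modeDensity (sineMode n) m x ≤ 2 / n * ∑ j, (m j : ℝ) := by
    intro x
    rw [modeDensity, Finset.mul_sum]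
    refine Finset.sum_le_sum fun j _ => ?_
    refine mul_le_mul_of_nonneg_right ?_ (Nat.cast_nonneg _)
    rw [sineMode, mul_pow, Real.sq_sqrt (by positivity)]
    exact mul_le_of_le_one_right (by positivity) (Real.sin_sq_le_one _)
  have h2 : ∀ x, 0 ≤ modeDensity (sineMode n) m x := fun x =>
    Finset.sum_nonneg fun j _ => by positivity
  calc _ ≤ 0 ^ 2 + ∑ x : Fin n, (2 / n * ∑ j, (m j : ℝ)) ^ 2 := by
        refine add_le_add_right (Finset.sum_le_sum fun x _ => ?_) _
        exact pow_le_pow_left₀ (h2 _) (h1 _) 2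
    _ = _ := by
        rw [Finset.sum_const, Finset.card_univ, Fintype.card_fin, nsmul_eq_mul]
        field_simp
        ring

/-- A lower bound on the Dirichlet partition function in terms of states with few particles and
small energy. -/
lemma sum_exp_le_dirichletPartition {N : ℕ} (hN : 1 ≤ N) {n : ℕ} (hn : 0 < n) {β A B δ : ℝ}
    (hβ : 0 ≤ β) (hA : 8 * A ^ 2 ≤ n) (hδ : 8 * A ^ 2 * B ≤ δ * n) (hδ0 : 0 ≤ δ)
    (F : Finset (Fin (n - 1) →₀ ℕ)) (hFA : ∀ m ∈ F, ∑ j, (m j : ℝ) ≤ A)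
    (hFB : ∀ m ∈ F, β * ∑ j, modeEnergy N n j * m j ≤ B) :
    1 / 2 * Real.exp (-δ) * ∑ m ∈ F, Real.exp (-(β * ∑ j, modeEnergy N n j * m j))
      ≤ dirichletPartition N β (n + 1) := by
  have hn' : (0 : ℝ) < n := by exact_mod_cast hn
  have hb := isBessel_spinVec (N := N) F (fockState (sineMode n))
    (fischer_fockState (isModes_sineMode n))
  -- Since the states are not normalized, the reference energy is raised by `δ`: the gain `δ w ≥ δ /
  -- 2` offsets the loss `β E (1 - w) ≤ δ / 2`, where `w ≥ 1 / 2` is the squared norm.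
  refine le_trans ?_ (le_gibbsTrace (dirichletHamiltonian_isHermitian N (n + 1)) β hb
    fun m => β * (∑ j, modeEnergy N n j * m j) + δ)
  rw [Finset.mul_sum]
  refine Finset.sum_le_sum fun m hm => ?_
  have h1 := mul_le_mul_of_nonneg_left (quadForm_dirichletHamiltonian_sine_le hN m) hβ
  have h2 := le_normSq_sine hN hn m
  set E := ∑ j, modeEnergy N n j * (m j : ℝ)
  set w := normSq (spinVec N (fockState (sineMode n) m))
  have hE : 0 ≤ β * E := mul_nonneg hβ
    (Finset.sum_nonneg fun j _ => mul_nonneg (modeEnergy_nonneg N n j) (Nat.cast_nonneg _))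
  have hM0 : 0 ≤ ∑ j, (m j : ℝ) := Finset.sum_nonneg fun j _ => Nat.cast_nonneg _
  have h3 : 4 * (∑ j, (m j : ℝ)) ^ 2 / n ≤ 4 * A ^ 2 / n := by
    have := hFA m hm
    gcongr
  have h4 : 4 * A ^ 2 / n ≤ 1 / 2 := by
    rw [div_le_iff₀ hn']; linarith
  have h5 : 1 - w ≤ 4 * A ^ 2 / n := by linarith
  have h6 : β * E * (4 * A ^ 2 / n) ≤ δ / 2 := by
    calc _ ≤ B * (4 * A ^ 2 / n) := by
          have := hFB m hm
          gcongr
      _ = (8 * A ^ 2 * B) / n / 2 := by ring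
      _ ≤ (δ * n) / n / 2 := by gcongr
      _ = _ := by rw [mul_div_cancel_right₀ _ hn'.ne']
  have h7 : 1 / 2 ≤ (1 + (β * E + δ)) * w - β * quadForm (dirichletHamiltonian N (n + 1))
      (spinVec N (fockState (sineMode n) m)) := by
    have h8 : β * E * (1 - w) ≤ δ / 2 := (mul_le_mul_of_nonneg_left h5 hE).trans h6
    have h9 : 1 / 2 ≤ w := by linarith
    have h10 : δ * (1 / 2) ≤ δ * w := mul_le_mul_of_nonneg_left h9 hδ0
    linarith
  calc _ = Real.exp (-(β * E + δ)) * (1 / 2) := by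
        rw [neg_add, Real.exp_add]; ring
    _ ≤ _ := by gcongr

end Block

/-! ### Markov's inequality for truncated geometric variables. -/

section Markov

/-- The mean of a geometric variable does not increase under truncation: summation by parts gives
equality up to the nonnegative term `D x ^ D`. -/
lemma sum_mul_pow_le {x : ℝ} (hx0 : 0 ≤ x) (hx1 : x < 1) (D : ℕ) :
    ∑ k ∈ Finset.range D, (k : ℝ) * x ^ k ≤ x / (1 - x) * ∑ k ∈ Finset.range D, x ^ k := by
  have h : (1 - x) * ∑ k ∈ Finset.range D, (k : ℝ) * x ^ k + D * x ^ D
      = x * ∑ k ∈ Finset.range D, x ^ k := by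
    induction D with
    | zero => simp
    | succ D ih =>
      rw [Finset.sum_range_succ, Finset.sum_range_succ, mul_add, mul_add x, ← ih]
      push_cast
      ring
  have h1 : 0 < 1 - x := by linarith
  rw [div_mul_eq_mul_div, le_div_iff₀ h1, ← h, mul_comm]
  have : 0 ≤ (D : ℝ) * x ^ D := by positivity
  linarith

variable {J : Type*} [Fintype J]

lemma exp_neg_sum (y : J → ℝ) (m : J → ℕ) :
    Real.exp (-∑ j, y j * m j) = ∏ j, Real.exp (-y j) ^ m j := by
  rw [← Finset.sum_neg_distrib, Real.exp_sum]
  refine Finset.prod_congr rfl fun j _ => ?_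
  rw [← Real.exp_nat_mul]
  congr 1
  ring

variable [DecidableEq J]

lemma sum_box_exp (y : J → ℝ) (D : ℕ) :
    ∑ m ∈ Fintype.piFinset fun _ : J => Finset.range D, Real.exp (-∑ j, y j * m j)
      = ∏ j, ∑ k ∈ Finset.range D, Real.exp (-y j) ^ k := by
  simp_rw [exp_neg_sum]
  rw [Finset.prod_univ_sum]

lemma sum_box_mul_exp_le {y : J → ℝ} (hy : ∀ j, 0 < y j) (D : ℕ) (i : J) :
    ∑ m ∈ Fintype.piFinset fun _ : J => Finset.range D, (m i : ℝ) * Real.exp (-∑ j, y j * m j)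
      ≤ 1 / (Real.exp (y i) - 1) * ∏ j, ∑ k ∈ Finset.range D, Real.exp (-y j) ^ k := by
  have h1 : ∀ m : J → ℕ, (m i : ℝ) * Real.exp (-∑ j, y j * m j)
      = ∏ j, (if j = i then (m j : ℝ) else 1) * Real.exp (-y j) ^ m j := by
    intro m
    rw [Finset.prod_mul_distrib, ← exp_neg_sum, Finset.prod_ite_eq' Finset.univ i]
    simp
  simp_rw [h1]
  rw [Finset.sum_prod_piFinset (Finset.range D)
    (fun j k => (if j = i then (k : ℝ) else 1) * Real.exp (-y j) ^ k),
    ← Finset.mul_prod_erase _ _ (Finset.mem_univ i),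
    ← Finset.mul_prod_erase (a := i) _ (fun j => ∑ k ∈ Finset.range D, Real.exp (-y j) ^ k)
      (Finset.mem_univ i), ← mul_assoc]
  have h2 : ∏ j ∈ Finset.univ.erase i,
      ∑ k ∈ Finset.range D, (if j = i then (k : ℝ) else 1) * Real.exp (-y j) ^ k
      = ∏ j ∈ Finset.univ.erase i, ∑ k ∈ Finset.range D, Real.exp (-y j) ^ k := by
    refine Finset.prod_congr rfl fun j hj => Finset.sum_congr rfl fun k _ => ?_
    rw [if_neg (Finset.ne_of_mem_erase hj), one_mul]
  rw [h2]
  refine mul_le_mul_of_nonneg_right ?_ (Finset.prod_nonneg fun j _ =>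
    Finset.sum_nonneg fun k _ => by positivity)
  simp only [if_true]
  refine (sum_mul_pow_le (Real.exp_pos _).le (Real.exp_lt_one_iff.2 (by linarith [hy i])) D).trans
    (le_of_eq ?_)
  congr 1
  have h3 : 0 < Real.exp (y i) - 1 := by
    have := Real.add_one_lt_exp (hy i).ne'
    linarith [hy i]
  rw [Real.exp_neg]
  field_simp

/-- Most of the weight of independent geometric variables is on states with few particles and
small energy. -/
lemma half_prod_le_sum_filter {y : J → ℝ} (hy : ∀ j, 0 < y j) {A B : ℝ} (hA : 0 < A) (hB : 0 < B)
    (hyA : ∑ j, 1 / (Real.exp (y j) - 1) ≤ A / 4)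
    (hyB : ∑ j, y j / (Real.exp (y j) - 1) ≤ B / 4) (D : ℕ) :
    1 / 2 * ∏ j, ∑ k ∈ Finset.range D, Real.exp (-y j) ^ k
      ≤ ∑ m ∈ Fintype.piFinset fun _ : J => Finset.range D with
          ∑ j, (m j : ℝ) ≤ A ∧ ∑ j, y j * m j ≤ B, Real.exp (-∑ j, y j * m j) := by
  set Z := ∏ j, ∑ k ∈ Finset.range D, Real.exp (-y j) ^ k with hZ
  have hZ0 : 0 ≤ Z := Finset.prod_nonneg fun j _ => Finset.sum_nonneg fun k _ => by positivity
  have h1 : ∑ m ∈ Fintype.piFinset fun _ : J => Finset.range D,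
      (∑ j, (m j : ℝ)) * Real.exp (-∑ j, y j * m j) ≤ A / 4 * Z := by
    simp_rw [Finset.sum_mul]
    rw [Finset.sum_comm]
    calc _ ≤ ∑ i, 1 / (Real.exp (y i) - 1) * Z :=
          Finset.sum_le_sum fun i _ => sum_box_mul_exp_le hy D i
      _ ≤ _ := by rw [← Finset.sum_mul]; gcongr
  have h2 : ∑ m ∈ Fintype.piFinset fun _ : J => Finset.range D,
      (∑ j, y j * (m j : ℝ)) * Real.exp (-∑ j, y j * m j) ≤ B / 4 * Z := by
    have : ∀ m : J → ℕ, (∑ j, y j * (m j : ℝ)) * Real.exp (-∑ j, y j * m j)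
        = ∑ i, y i * ((m i : ℝ) * Real.exp (-∑ j, y j * m j)) := by
      intro m
      rw [Finset.sum_mul]
      simp_rw [mul_assoc]
    simp_rw [this]
    rw [Finset.sum_comm]
    calc _ ≤ ∑ i, y i / (Real.exp (y i) - 1) * Z := by
          refine Finset.sum_le_sum fun i _ => ?_
          rw [← Finset.mul_sum]
          refine (mul_le_mul_of_nonneg_left (sum_box_mul_exp_le hy D i) (hy i).le).trans
            (le_of_eq ?_)
          ring
      _ ≤ _ := by rw [← Finset.sum_mul]; gcongr
  rw [Finset.sum_filter]
  -- Each of the two constraints excludes at most a quarter of the weight. The indicator of the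
  -- allowed states is at least `1 - M / A - E / B`, for `M` particles and energy `E`.
  calc _ = Z - (A / 4 * Z) / A - (B / 4 * Z) / B := by field_simp; ring
    _ ≤ Z - (∑ m ∈ Fintype.piFinset fun _ : J => Finset.range D,
          (∑ j, (m j : ℝ)) * Real.exp (-∑ j, y j * m j)) / A
        - (∑ m ∈ Fintype.piFinset fun _ : J => Finset.range D,
          (∑ j, y j * (m j : ℝ)) * Real.exp (-∑ j, y j * m j)) / B := by gcongr
    _ = ∑ m ∈ Fintype.piFinset fun _ : J => Finset.range D,
        (1 - (∑ j, (m j : ℝ)) / A - (∑ j, y j * (m j : ℝ)) / B)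
          * Real.exp (-∑ j, y j * m j) := by
        rw [hZ, ← sum_box_exp, Finset.sum_div, Finset.sum_div, ← Finset.sum_sub_distrib,
          ← Finset.sum_sub_distrib]
        refine Finset.sum_congr rfl fun m _ => by ring
    _ ≤ _ := by
        refine Finset.sum_le_sum fun m _ => ?_
        have hM0 : 0 ≤ (∑ j, (m j : ℝ)) / A :=
          div_nonneg (Finset.sum_nonneg fun j _ => Nat.cast_nonneg _) hA.le
        have hE0 : 0 ≤ (∑ j, y j * (m j : ℝ)) / B := div_nonneg
          (Finset.sum_nonneg fun j _ => mul_nonneg (hy j).le (Nat.cast_nonneg _)) hB.le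
        have he := Real.exp_pos (-∑ j, y j * (m j : ℝ))
        split_ifs with h
        · exact mul_le_of_le_one_left he.le (by linarith)
        · refine mul_nonpos_of_nonpos_of_nonneg ?_ he.le
          rw [not_and_or, not_le, not_le, ← one_lt_div hA, ← one_lt_div hB] at h
          rcases h with h | h <;> linarith

end Markov

/-! ### Removal of the cutoff on the occupation numbers. -/

section Block

lemma le_dirichletPartition {N : ℕ} (hN : 1 ≤ N) {n : ℕ} (hn : 0 < n) {β A B δ : ℝ}
    (hβ : 0 < β) (hA : 0 < A) (hB : 0 < B) (hAn : 8 * A ^ 2 ≤ n) (hδ : 8 * A ^ 2 * B ≤ δ * n)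
    (hy : ∀ j, 0 < β * modeEnergy N n j)
    (hyA : ∑ j, 1 / (Real.exp (β * modeEnergy N n j) - 1) ≤ A / 4)
    (hyB : ∑ j, β * modeEnergy N n j / (Real.exp (β * modeEnergy N n j) - 1) ≤ B / 4) :
    1 / 4 * Real.exp (-δ) * ∏ j, (1 - Real.exp (-(β * modeEnergy N n j)))⁻¹
      ≤ dirichletPartition N β (n + 1) := by
  have hn' : (0 : ℝ) < n := by exact_mod_cast hn
  have hδ0 : 0 ≤ δ := by
    have h1 : 0 ≤ δ * n := le_trans (by positivity) hδ
    exact nonneg_of_mul_nonneg_left h1 hn'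
  -- The cutoff `D` keeps the family of trial states finite. Since `A`, `B` and `δ` do not depend on
  -- it, it can be sent to infinity.
  have hlim : Tendsto (fun D : ℕ => 1 / 4 * Real.exp (-δ) *
      ∏ j, ∑ k ∈ Finset.range D, Real.exp (-(β * modeEnergy N n j)) ^ k) atTop
      (𝓝 (1 / 4 * Real.exp (-δ) * ∏ j, (1 - Real.exp (-(β * modeEnergy N n j)))⁻¹)) := by
    refine Tendsto.const_mul _ (tendsto_finsetProd _ fun j _ => ?_)
    exact (hasSum_geometric_of_lt_one (Real.exp_pos _).le
      (Real.exp_lt_one_iff.2 (by linarith [hy j]))).tendsto_sum_nat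
  refine le_of_tendsto' hlim fun D => ?_
  have h1 := half_prod_le_sum_filter hy hA hB hyA hyB D
  set F := Finset.filter (fun m : Fin (n - 1) → ℕ => ∑ j, (m j : ℝ) ≤ A ∧
    ∑ j, β * modeEnergy N n j * m j ≤ B) (Fintype.piFinset fun _ => Finset.range D) with hF
  have hE : ∀ m : Fin (n - 1) → ℕ, β * ∑ j, modeEnergy N n j * m j
      = ∑ j, β * modeEnergy N n j * m j := by
    intro m
    rw [Finset.mul_sum]
    simp_rw [mul_assoc]
  have h2 := sum_exp_le_dirichletPartition hN hn hβ.le hAn hδ hδ0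
    (F.map Finsupp.equivFunOnFinite.symm.toEmbedding) (by
      intro m hm
      obtain ⟨m', hm', rfl⟩ := Finset.mem_map.1 hm
      exact (Finset.mem_filter.1 hm').2.1) (by
      intro m hm
      obtain ⟨m', hm', rfl⟩ := Finset.mem_map.1 hm
      exact (hE m').trans_le (Finset.mem_filter.1 hm').2.2)
  rw [Finset.sum_map] at h2
  refine le_trans ?_ h2
  have h3 : ∀ m : Fin (n - 1) → ℕ, β * ∑ j, modeEnergy N n j *
      ((Finsupp.equivFunOnFinite.symm.toEmbedding m : Fin (n - 1) →₀ ℕ) j : ℝ)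
      = ∑ j, β * modeEnergy N n j * m j := hE
  simp_rw [h3]
  calc _ = 1 / 2 * Real.exp (-δ) * (1 / 2 *
        ∏ j, ∑ k ∈ Finset.range D, Real.exp (-(β * modeEnergy N n j)) ^ k) := by ring
    _ ≤ _ := by gcongr

end Block

end Heisenberg

namespace Heisenberg

/-! ### The Bose integral and its Riemann sums. -/

section BoseIntegral

open Real MeasureTheory Set

/-- The free energy density of a momentum mode. -/
def boseLog (p : ℝ) : ℝ := -log (1 - exp (-p ^ 2))

lemma one_sub_exp_pos {y : ℝ} (hy : 0 < y) : 0 < 1 - exp (-y) := by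
  have := exp_lt_one_iff.2 (neg_neg_of_pos hy)
  linarith

lemma boseLog_nonneg (p : ℝ) : 0 ≤ boseLog p := by
  rw [boseLog, neg_nonneg]
  refine log_nonpos ?_ (by linarith [exp_pos (-p ^ 2)])
  have : exp (-p ^ 2) ≤ 1 := exp_le_one_iff.2 (by nlinarith [sq_nonneg p])
  linarith

lemma boseLog_antitoneOn : AntitoneOn boseLog (Ioi 0) := by
  intro p hp q hq hpq
  have hp' : (0 : ℝ) < p := hp
  have h1 : exp (-q ^ 2) ≤ exp (-p ^ 2) := exp_le_exp.2 (neg_le_neg (by gcongr))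
  exact neg_le_neg (log_le_log (one_sub_exp_pos (by positivity)) (by linarith))

lemma boseLog_le_inv_sq {p : ℝ} (hp : 0 < p) : boseLog p ≤ (p ^ 2)⁻¹ := by
  have hp2 : 0 < p ^ 2 := by positivity
  have h0 := one_sub_exp_pos hp2
  have h1 := one_sub_inv_le_log_of_pos h0
  have h2 : (1 - exp (-p ^ 2))⁻¹ ≤ 1 + (p ^ 2)⁻¹ := by
    rw [inv_le_comm₀ h0 (by positivity)]
    have h3 : exp (-p ^ 2) ≤ (1 + p ^ 2)⁻¹ := by
      rw [exp_neg]
      exact inv_anti₀ (by positivity) (by linarith [add_one_le_exp (p ^ 2)])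
    have h4 : (1 + (p ^ 2)⁻¹)⁻¹ = 1 - (1 + p ^ 2)⁻¹ := by field_simp; ring
    linarith
  rw [boseLog]
  linarith

lemma boseLog_le_log {p : ℝ} (hp : 0 < p) (hp1 : p ≤ 1) : boseLog p ≤ log 2 - 2 * log p := by
  have hp2 : 0 < p ^ 2 := by positivity
  have h3 : exp (-p ^ 2) ≤ (1 + p ^ 2)⁻¹ := by
    rw [exp_neg]
    exact inv_anti₀ (by positivity) (by linarith [add_one_le_exp (p ^ 2)])
  have h4 : p ^ 2 / 2 ≤ 1 - exp (-p ^ 2) := by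
    have h5 : p ^ 2 / 2 ≤ 1 - (1 + p ^ 2)⁻¹ := by
      rw [show 1 - (1 + p ^ 2)⁻¹ = p ^ 2 / (1 + p ^ 2) by field_simp; ring]
      gcongr
      nlinarith
    linarith
  have h5 := log_le_log (by positivity) h4
  rw [log_div hp2.ne' two_ne_zero, log_pow] at h5
  rw [boseLog]
  push_cast at h5
  linarith

lemma measurable_boseLog : Measurable boseLog := by
  unfold boseLog
  fun_prop

lemma integrableOn_boseLog_Ioc {s : ℝ} (hs : s ≤ 1) (hs0 : 0 ≤ s) :
    IntegrableOn boseLog (Ioc 0 s) := by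
  have h : IntegrableOn (fun p => log 2 - 2 * log p) (Ioc 0 s) := by
    have := (intervalIntegral.intervalIntegrable_log' (a := 0) (b := s)).const_mul 2
    have h2 := (intervalIntegrable_const (c := log 2) (a := 0) (b := s) (μ := volume)).sub this
    rwa [intervalIntegrable_iff_integrableOn_Ioc_of_le hs0] at h2
  refine Integrable.mono' h measurable_boseLog.aestronglyMeasurable ?_
  filter_upwards [ae_restrict_mem measurableSet_Ioc] with p hp
  rw [norm_of_nonneg (boseLog_nonneg p)]
  exact boseLog_le_log hp.1 (hp.2.trans hs)

lemma integral_boseLog_le {s : ℝ} (hs : s ≤ 1) (hs0 : 0 ≤ s) :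
    ∫ p in Ioc 0 s, boseLog p ≤ s * (log 2 + 2 - 2 * log s) := by
  have h0 := (intervalIntegral.intervalIntegrable_log' (a := 0) (b := s)).const_mul 2
  have h1 := intervalIntegrable_const (c := log 2) (a := 0) (b := s) (μ := volume)
  have h2 := h1.sub h0
  have h3 : ∫ p in (0)..s, (log 2 - 2 * log p) = s * (log 2 + 2 - 2 * log s) := by
    rw [intervalIntegral.integral_sub h1 h0, intervalIntegral.integral_const,
      intervalIntegral.integral_const_mul, integral_log]
    simp
    ring
  rw [← h3, intervalIntegral.integral_of_le hs0]
  rw [intervalIntegrable_iff_integrableOn_Ioc_of_le hs0] at h2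
  refine setIntegral_mono_on (integrableOn_boseLog_Ioc hs hs0) h2 measurableSet_Ioc fun p hp => ?_
  exact boseLog_le_log hp.1 (hp.2.trans hs)

lemma integrableOn_inv_sq {b : ℝ} (hb : 0 < b) : IntegrableOn (fun p : ℝ => (p ^ 2)⁻¹) (Ioi b) := by
  refine (integrableOn_Ioi_rpow_of_lt (a := -2) (by norm_num) hb).congr_fun (fun p hp => ?_)
    measurableSet_Ioi
  have hp' : (0 : ℝ) < p := hb.trans hp
  simp only
  rw [rpow_neg hp'.le, rpow_two]

lemma integrableOn_boseLog_Ioi {b : ℝ} (hb : 0 < b) : IntegrableOn boseLog (Ioi b) := by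
  refine Integrable.mono' (integrableOn_inv_sq hb) measurable_boseLog.aestronglyMeasurable ?_
  filter_upwards [ae_restrict_mem measurableSet_Ioi] with p hp
  rw [norm_of_nonneg (boseLog_nonneg p)]
  exact boseLog_le_inv_sq (hb.trans hp)

lemma integral_boseLog_Ioi_le {b : ℝ} (hb : 0 < b) : ∫ p in Ioi b, boseLog p ≤ b⁻¹ := by
  have h : ∫ p in Ioi b, (p ^ 2)⁻¹ = b⁻¹ := by
    have h1 := integral_Ioi_rpow_of_lt (a := -2) (by norm_num) hb
    rw [show (-2 : ℝ) + 1 = -1 by norm_num, rpow_neg_one, neg_div_neg_eq, div_one] at h1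
    rw [← h1]
    refine setIntegral_congr_fun measurableSet_Ioi fun p hp => ?_
    have hp' : (0 : ℝ) < p := hb.trans hp
    rw [rpow_neg hp'.le, rpow_two]
  rw [← h]
  exact setIntegral_mono_on (integrableOn_boseLog_Ioi hb) (integrableOn_inv_sq hb)
    measurableSet_Ioi fun p hp => boseLog_le_inv_sq (hb.trans hp)

lemma integrableOn_boseLog : IntegrableOn boseLog (Ioi 0) := by
  rw [← Ioc_union_Ioi_eq_Ioi zero_le_one]
  exact (integrableOn_boseLog_Ioc le_rfl zero_le_one).union (integrableOn_boseLog_Ioi one_pos)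

/-- The absolute value of the constant `C₁`. -/
def boseConst : ℝ := 1 / π * ∫ p in Ioi 0, boseLog p

lemma C₁_eq : C₁ = -boseConst := by
  have h : ∫ p : ℝ, log (1 - exp (-p ^ 2)) = -(2 * ∫ p in Ioi 0, boseLog p) := by
    rw [← integral_comp_abs (f := boseLog), ← integral_neg]
    congr 1
    ext p
    rw [boseLog, sq_abs, neg_neg]
  rw [C₁, h, boseConst]
  have := pi_pos
  field_simp

lemma boseConst_pos : 0 < boseConst := by
  have h1 : ∫ p in Ioc (0 : ℝ) 1, boseLog 1 ≤ ∫ p in Ioc 0 1, boseLog p :=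
    setIntegral_mono_on (integrableOn_const (by simp))
      (integrableOn_boseLog_Ioc le_rfl zero_le_one) measurableSet_Ioc fun p hp =>
        boseLog_antitoneOn hp.1 (mem_Ioi.2 one_pos) hp.2
  have h2 : ∫ p in Ioc (0 : ℝ) 1, boseLog p ≤ ∫ p in Ioi 0, boseLog p :=
    setIntegral_mono_set integrableOn_boseLog (ae_of_all _ boseLog_nonneg)
      (Ioc_subset_Ioi_self.eventuallyLE)
  have h3 : 0 < boseLog 1 := by
    rw [boseLog, neg_pos]
    exact log_neg (one_sub_exp_pos (by norm_num)) (by linarith [exp_pos (-(1 : ℝ) ^ 2)])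
  rw [setIntegral_const] at h1
  simp at h1
  rw [boseConst]
  have := pi_pos
  have : 0 < ∫ p in Ioi 0, boseLog p := by linarith
  positivity

/-- By monotonicity the sum dominates the integral over `[s, s n]` divided by the spacing `s = π /
t`. The missing piece near `0` has a logarithmic singularity and costs about `2 log t`; the missing
tail costs at most `1` because `t ^ 2 ≤ n`. -/
lemma le_sum_boseLog {n : ℕ} (hn : 1 ≤ n) {t : ℝ} (ht : π ≤ t) (htn : t ^ 2 ≤ n) :
    t * boseConst - 4 - 2 * log t ≤ ∑ j ∈ Finset.range (n - 1), boseLog (π / t * (1 + j)) := by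
  have hπ := pi_pos
  have ht0 : 0 < t := hπ.trans_le ht
  set s := π / t with hs
  have hs0 : 0 < s := div_pos hπ ht0
  have hs1 : s ≤ 1 := div_le_one_of_le₀ ht ht0.le
  have hn1 : (1 : ℝ) ≤ n := by exact_mod_cast hn
  have hsn : s ≤ s * n := le_mul_of_one_le_right hs0.le hn1
  have h1 : ∫ x in (1 : ℝ)..n, boseLog (s * x)
      ≤ ∑ j ∈ Finset.range (n - 1), boseLog (s * (1 + j)) := by
    have h := AntitoneOn.integral_le_sum (x₀ := 1) (a := n - 1) (f := fun x => boseLog (s * x)) (by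
      intro x hx y hy hxy
      have hx0 : (0 : ℝ) < x := by linarith [hx.1]
      have hy0 : (0 : ℝ) < y := by linarith [hy.1]
      exact boseLog_antitoneOn (mul_pos hs0 hx0) (mul_pos hs0 hy0) (by gcongr))
    rw [Nat.cast_sub hn, Nat.cast_one, add_sub_cancel] at h
    exact h
  rw [intervalIntegral.integral_comp_mul_left _ hs0.ne', mul_one, smul_eq_mul,
    intervalIntegral.integral_of_le hsn] at h1
  have h2 : ∫ p in Ioi 0, boseLog p = (∫ p in Ioc 0 s, boseLog p)
      + ((∫ p in Ioc s (s * n), boseLog p) + ∫ p in Ioi (s * n), boseLog p) := by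
    have i1 := integrableOn_boseLog_Ioi hs0
    rw [← Ioc_union_Ioi_eq_Ioi hs0.le, setIntegral_union (Ioc_disjoint_Ioi le_rfl) measurableSet_Ioi
      (integrableOn_boseLog_Ioc hs1 hs0.le) i1]
    congr 1
    rw [← Ioc_union_Ioi_eq_Ioi hsn, setIntegral_union (Ioc_disjoint_Ioi le_rfl) measurableSet_Ioi
      (i1.mono_set Ioc_subset_Ioi_self) (i1.mono_set (Ioi_subset_Ioi hsn))]
  have h3 := integral_boseLog_le hs1 hs0.le
  have h4 := integral_boseLog_Ioi_le (hs0.trans_le hsn)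
  have h5 : t * boseConst = s⁻¹ * ∫ p in Ioi 0, boseLog p := by
    rw [boseConst, hs, inv_div]
    ring
  have h6 : s⁻¹ * (∫ p in Ioc 0 s, boseLog p) ≤ log 2 + 2 - 2 * log s := by
    rw [inv_mul_le_iff₀ hs0]
    exact h3
  have h7 : s⁻¹ * (∫ p in Ioi (s * n), boseLog p) ≤ 1 := by
    rw [inv_mul_le_iff₀ hs0, mul_one]
    refine h4.trans ?_
    rw [inv_le_comm₀ (hs0.trans_le hsn) hs0]
    rw [inv_div]
    have h8 : t / π ≤ t := div_le_self ht0.le (by linarith [pi_gt_three])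
    refine h8.trans ?_
    rw [div_mul_eq_mul_div, le_div_iff₀ ht0]
    have : (n : ℝ) ≤ π * n := le_mul_of_one_le_left (by linarith) (by linarith [pi_gt_three])
    nlinarith
  have h8 : log s = log π - log t := log_div hπ.ne' ht0.ne'
  have h9 : log 2 ≤ 1 := by linarith [log_two_lt_d9]
  have h10 : 0 ≤ log π := log_nonneg (by linarith [pi_gt_three])
  rw [h5, h2, mul_add, mul_add]
  linarith

end BoseIntegral

/-! ### The block in units of the thermal wave length. -/

section BlockBound

open Real

lemma sum_inv_sq_le (m : ℕ) : ∑ j ∈ Finset.range m, 1 / ((j : ℝ) + 1) ^ 2 ≤ 2 - 1 / (m : ℝ) := by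
  induction m with
  | zero => simp
  | succ m ih =>
    rw [Finset.sum_range_succ]
    rcases eq_or_ne m 0 with rfl | hm
    · norm_num
    have hm' : (0 : ℝ) < m := by positivity
    have h : 1 / ((m : ℝ) + 1) ^ 2 ≤ 1 / m - 1 / (m + 1) := by
      rw [show 1 / (m : ℝ) - 1 / (m + 1) = 1 / (m * (m + 1)) by field_simp; ring, sq]
      gcongr
      linarith
    push_cast
    linarith

lemma sum_inv_one_add_sq_le {a : ℝ} (ha : 0 < a) (m : ℕ) :
    ∑ j ∈ Finset.range m, 1 / (1 + a * ((j : ℝ) + 1)) ^ 2 ≤ 1 / a * (1 - 1 / (1 + a * m)) := by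
  induction m with
  | zero => simp
  | succ m ih =>
    rw [Finset.sum_range_succ]
    have hp : 0 < 1 + a * (m : ℝ) := by positivity
    have hq : 0 < 1 + a * ((m : ℝ) + 1) := by positivity
    have h : 1 / (1 + a * ((m : ℝ) + 1)) ^ 2
        ≤ 1 / a * (1 / (1 + a * m) - 1 / (1 + a * (m + 1))) := by
      rw [show 1 / a * (1 / (1 + a * m) - 1 / (1 + a * (m + 1)))
        = 1 / ((1 + a * m) * (1 + a * (m + 1))) by field_simp; ring, sq]
      gcongr
      linarith
    push_cast
    calc _ ≤ 1 / a * (1 - 1 / (1 + a * m)) + 1 / a * (1 / (1 + a * m) - 1 / (1 + a * (m + 1))) :=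
          add_le_add ih h
      _ = _ := by ring

lemma one_div_exp_sub_one_le {y : ℝ} (hy : 0 < y) : 1 / (exp y - 1) ≤ 1 / y := by
  have := add_one_le_exp y
  gcongr
  linarith

/-- This follows from `exp y ≥ 1 + y + y² / 2`. With `y` of order `(j / t)²` the bound stays below
`1` and is summable in `j`, so that the total energy is of order `t`. -/
lemma div_exp_sub_one_le {y : ℝ} (hy : 0 < y) : y / (exp y - 1) ≤ 1 / (1 + y / 2) := by
  have h := quadratic_le_exp_of_nonneg hy.le
  rw [div_le_div_iff₀ (by nlinarith) (by positivity)]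
  nlinarith

variable {N n : ℕ} {β t : ℝ}

/-- Jordan's inequality `sin x ≥ 2 x / π` on `[0, π / 2]`. It loses only a constant, which is
harmless in bounds on particle number and energy; the sharp constant comes from `mul_modeEnergy_le`.
-/
lemma le_mul_modeEnergy (hβ : 0 < β) (ht : 0 < t) (htn : β * spin N * t ^ 2 = n ^ 2)
    (j : Fin (n - 1)) : 4 * ((j : ℝ) + 1) ^ 2 / t ^ 2 ≤ β * modeEnergy N n j := by
  have hj := j.2
  have hn' : (0 : ℝ) < n := by exact_mod_cast (by omega : 0 < n)
  have hjn : ((j : ℕ) : ℝ) + 1 ≤ n := by exact_mod_cast (by omega : (j : ℕ) + 1 ≤ n)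
  have hπ := pi_pos
  have h1 := mul_le_sin (x := π * (j + 1 : ℕ) / n / 2) (by positivity) (by
    push_cast
    rw [div_le_div_iff_of_pos_right two_pos, div_le_iff₀ hn']
    gcongr)
  have h2 : 2 / π * (π * (j + 1 : ℕ) / n / 2) = ((j : ℝ) + 1) / n := by
    push_cast
    field_simp
  rw [h2] at h1
  have h3 : (((j : ℝ) + 1) / n) ^ 2 ≤ sin (π * (j + 1 : ℕ) / n / 2) ^ 2 := by gcongr
  have hX : 0 ≤ β * spin N := by rw [spin]; positivity
  calc _ = 4 * (β * spin N) * (((j : ℝ) + 1) / n) ^ 2 := by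
        have h4 : β * spin N = n ^ 2 / t ^ 2 := by
          rw [← htn, mul_div_cancel_right₀ _ (by positivity)]
        rw [h4]
        field_simp
    _ ≤ 4 * (β * spin N) * sin (π * (j + 1 : ℕ) / n / 2) ^ 2 := by gcongr
    _ = _ := by rw [modeEnergy]; ring

lemma mul_modeEnergy_le (hβ : 0 < β) (ht : 0 < t) (htn : β * spin N * t ^ 2 = n ^ 2)
    (j : Fin (n - 1)) : β * modeEnergy N n j ≤ (π / t * (1 + (j : ℝ))) ^ 2 := by
  have hj := j.2
  have hn' : (0 : ℝ) < n := by exact_mod_cast (by omega : 0 < n)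
  have hπ := pi_pos
  have hX : 0 ≤ β * spin N := by rw [spin]; positivity
  have h1 : sin (π * (j + 1 : ℕ) / n / 2) ^ 2 ≤ (π * (j + 1 : ℕ) / n / 2) ^ 2 := sin_sq_le_sq
  calc _ = 4 * (β * spin N) * sin (π * (j + 1 : ℕ) / n / 2) ^ 2 := by rw [modeEnergy]; ring
    _ ≤ 4 * (β * spin N) * (π * (j + 1 : ℕ) / n / 2) ^ 2 := by gcongr
    _ = β * spin N * t ^ 2 / n ^ 2 * (π / t * (1 + (j : ℝ))) ^ 2 := by
        push_cast
        field_simp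
        ring
    _ = _ := by rw [htn, div_self (by positivity), one_mul]

/-- The partition function of a Dirichlet block whose length is `t` thermal wave lengths. -/
lemma le_log_dirichletPartition (hN : 1 ≤ N) (hn : 1 ≤ n) (hβ : 0 < β) (ht : π ≤ t)
    (htn : β * spin N * t ^ 2 = n ^ 2) (htn' : 32 * t ^ 4 ≤ n) :
    t * boseConst - 6 - 2 * log t - 256 * t ^ 5 / n
      ≤ log (dirichletPartition N β (n + 1)) := by
  have hπ := pi_pos
  have ht0 : 0 < t := hπ.trans_le ht
  have ht1 : 1 ≤ t := by linarith [pi_gt_three]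
  have hn' : (0 : ℝ) < n := by exact_mod_cast hn
  have hlow := fun j => le_mul_modeEnergy hβ ht0 htn j
  have hpos : ∀ j, 0 < β * modeEnergy N n j := fun j => lt_of_lt_of_le (by positivity) (hlow j)
  have hA : ∑ j, 1 / (exp (β * modeEnergy N n j) - 1) ≤ 2 * t ^ 2 / 4 := by
    calc _ ≤ ∑ j : Fin (n - 1), t ^ 2 / 4 * (1 / ((j : ℝ) + 1) ^ 2) := by
          refine Finset.sum_le_sum fun j _ => (one_div_exp_sub_one_le (hpos j)).trans ?_
          calc _ ≤ 1 / (4 * ((j : ℝ) + 1) ^ 2 / t ^ 2) :=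
                one_div_le_one_div_of_le (by positivity) (hlow j)
            _ = _ := by field_simp
      _ ≤ t ^ 2 / 4 * 2 := by
          rw [← Finset.mul_sum,
            Fin.sum_univ_eq_sum_range (fun j : ℕ => 1 / ((j : ℝ) + 1) ^ 2)]
          gcongr
          refine (sum_inv_sq_le _).trans ?_
          have : (0 : ℝ) ≤ 1 / ((n - 1 : ℕ) : ℝ) := by positivity
          linarith
      _ = _ := by ring
  have hB : ∑ j, β * modeEnergy N n j / (exp (β * modeEnergy N n j) - 1) ≤ 8 * t / 4 := by
    calc _ ≤ ∑ j : Fin (n - 1), 2 * (1 / (1 + 1 / t * ((j : ℝ) + 1)) ^ 2) := by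
          refine Finset.sum_le_sum fun j _ => (div_exp_sub_one_le (hpos j)).trans ?_
          rw [mul_one_div, div_le_div_iff₀ (by linarith [hpos j]) (by positivity)]
          have h1 := hlow j
          have h2 : 4 * ((j : ℝ) + 1) ^ 2 / t ^ 2 = 4 * (1 / t * ((j : ℝ) + 1)) ^ 2 := by
            field_simp
          rw [h2] at h1
          nlinarith [sq_nonneg (1 / t * ((j : ℝ) + 1) - 1)]
      _ ≤ 2 * (1 / (1 / t)) := by
          rw [← Finset.mul_sum,
            Fin.sum_univ_eq_sum_range (fun j : ℕ => 1 / (1 + 1 / t * ((j : ℝ) + 1)) ^ 2)]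
          gcongr
          refine (sum_inv_one_add_sq_le (by positivity) _).trans ?_
          refine mul_le_of_le_one_right (by positivity) ?_
          have : (0 : ℝ) ≤ 1 / (1 + 1 / t * ((n - 1 : ℕ) : ℝ)) := by positivity
          linarith
      _ = _ := by rw [one_div_one_div]; ring
  -- `A` and `B` are four times the bounds `t² / 2` and `2 t` on mean particle number and mean
  -- energy. Then `8 A² = 32 t⁴` and `8 A² B = 256 t⁵`.
  have h := le_dirichletPartition hN hn (A := 2 * t ^ 2) (B := 8 * t) (δ := 256 * t ^ 5 / n) hβ
    (by positivity) (by positivity) (by linarith) (by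
      rw [div_mul_cancel₀ _ hn'.ne']
      apply le_of_eq
      ring) hpos hA hB
  have hprod : 0 < ∏ j, (1 - exp (-(β * modeEnergy N n j)))⁻¹ :=
    Finset.prod_pos fun j _ => inv_pos.2 (one_sub_exp_pos (hpos j))
  have hlog := log_le_log (by positivity) h
  rw [log_mul (by positivity) hprod.ne', log_mul (by norm_num) (exp_pos _).ne', log_exp,
    log_prod (fun j _ => (inv_pos.2 (one_sub_exp_pos (hpos j))).ne')] at hlog
  have hsum : ∑ j ∈ Finset.range (n - 1), boseLog (π / t * (1 + j))
      ≤ ∑ j, log (1 - exp (-(β * modeEnergy N n j)))⁻¹ := by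
    rw [← Fin.sum_univ_eq_sum_range (fun j : ℕ => boseLog (π / t * (1 + j)))]
    refine Finset.sum_le_sum fun j _ => ?_
    rw [log_inv, boseLog]
    refine neg_le_neg (log_le_log (one_sub_exp_pos (hpos j)) ?_)
    have := exp_le_exp.2 (neg_le_neg (mul_modeEnergy_le hβ ht0 htn j))
    linarith
  have h1 := le_sum_boseLog hn ht (by linarith [pow_le_pow_right₀ ht1 (show 2 ≤ 4 by norm_num)])
  have h2 : log (1 / 4 : ℝ) = -(2 * log 2) := by
    rw [one_div, log_inv, show (4 : ℝ) = 2 ^ 2 by norm_num, log_pow]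
    push_cast
    rfl
  linarith [log_two_lt_d9]

end BlockBound

end Heisenberg

namespace Heisenberg

/-! ### Choice of the block length. -/

section Asymptotics

open Real

lemma exists_forall_log_rpow_le : ∃ X₀ : ℝ, 1 < X₀ ∧ ∀ X, X₀ ≤ X →
    1 ≤ log X ∧ 512 * log X ^ (3 / 4 : ℝ) ≤ X ^ (1 / 8 : ℝ) := by
  have h1 := (isLittleO_log_rpow_rpow_atTop (s := 1 / 8) (3 / 4) (by norm_num)).bound
    (show (0 : ℝ) < 1 / 512 by norm_num)
  obtain ⟨a, ha⟩ := eventually_atTop.1 h1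
  refine ⟨max a (exp 1), lt_max_of_lt_right (by linarith [add_one_lt_exp one_ne_zero]),
    fun X hX => ?_⟩
  have hX1 : exp 1 ≤ X := (le_max_right _ _).trans hX
  have hX0 : 0 < X := (exp_pos 1).trans_le hX1
  have hl : 1 ≤ log X := (le_log_iff_exp_le hX0).2 hX1
  refine ⟨hl, ?_⟩
  have h2 := ha X ((le_max_left _ _).trans hX)
  rw [norm_of_nonneg (by positivity), norm_of_nonneg (by positivity)] at h2
  linarith

/-- The upper bound on the free energy, in terms of `R = (β S) ^ (1 / 8)` and
`w = (ln (β S)) ^ (1 / 4)`. -/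
lemma freeEnergy_le_of_large {N : ℕ} {β R w : ℝ} (hN : 1 ≤ N) (hβ : 0 < β) (hw : 1 ≤ w)
    (hR : 512 * w ^ 3 ≤ R) (hX : β * spin N = R ^ 8) (hlog : log (R ^ 8) = w ^ 4) :
    freeEnergy N β ≤ -boseConst * (β⁻¹ * (R ^ 4)⁻¹)
      * (1 - (4107 + boseConst) / boseConst * (R⁻¹ * w ^ 3)) := by
  have hD := boseConst_pos
  have hw0 : 0 < w := by linarith
  have hw3 : 1 ≤ w ^ 3 := one_le_pow₀ hw
  have hw4 : 1 ≤ w ^ 4 := one_le_pow₀ hw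
  have hww : w ≤ w ^ 4 := le_self_pow₀ hw (by norm_num)
  have hR1 : 512 ≤ R := by linarith
  have hR0 : 0 < R := by linarith
  have hRw : 512 ≤ R * w := by nlinarith
  -- The thermal wave length is `R ^ 4`, so `t` lies between `R w` and `2 R w`. Then `t⁵ / n = (t /
  -- R)⁴` is of the order `w⁴ = log (R ^ 8)`, like the error `log t`. The constant `512 = 32 * 2⁴`
  -- in `hR` secures `32 t⁴ ≤ n`.
  set n := ⌈R ^ 5 * w⌉₊ with hn
  have hn1 : R ^ 5 * w ≤ n := Nat.le_ceil _
  have hR5 : 1 ≤ R ^ 5 * w := by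
    have : 1 ≤ R ^ 5 := one_le_pow₀ (by linarith)
    nlinarith
  have hn2 : (n : ℝ) ≤ 2 * (R ^ 5 * w) := by
    have := Nat.ceil_lt_add_one (show 0 ≤ R ^ 5 * w by positivity)
    linarith
  have hn0 : (0 : ℝ) < n := by linarith
  set t := (n : ℝ) / R ^ 4 with ht
  have ht1 : R * w ≤ t := by
    rw [ht, le_div_iff₀ (by positivity)]
    linarith [show R * w * R ^ 4 = R ^ 5 * w by ring]
  have ht2 : t ≤ 2 * (R * w) := by
    rw [ht, div_le_iff₀ (by positivity)]
    linarith [show 2 * (R * w) * R ^ 4 = 2 * (R ^ 5 * w) by ring]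
  have ht0 : 0 < t := by linarith
  have hnt : (n : ℝ) = t * R ^ 4 := by rw [ht, div_mul_cancel₀ _ (by positivity)]
  have ht4 : t ^ 4 ≤ 16 * R ^ 4 * w ^ 4 := by
    calc t ^ 4 ≤ (2 * (R * w)) ^ 4 := by gcongr
      _ = _ := by ring
  have hZ := le_log_dirichletPartition (t := t) (n := n) hN
    (by exact_mod_cast (show (1 : ℝ) ≤ n by linarith)) hβ
    (by linarith [pi_lt_four]) (by rw [hX, hnt]; ring) (by
      calc 32 * t ^ 4 ≤ 32 * (16 * R ^ 4 * w ^ 4) := by gcongr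
        _ = (512 * w ^ 3) * (R ^ 4 * w) := by ring
        _ ≤ R * (R ^ 4 * w) := by gcongr
        _ = R ^ 5 * w := by ring
        _ ≤ n := hn1)
  have h1 : 256 * t ^ 5 / n ≤ 4096 * w ^ 4 := by
    rw [div_le_iff₀ hn0, hnt]
    calc 256 * t ^ 5 = 256 * t * t ^ 4 := by ring
      _ ≤ 256 * t * (16 * R ^ 4 * w ^ 4) := by gcongr
      _ = _ := by ring
  have h2 : log t ≤ 1 + w ^ 4 / 8 + w ^ 4 := by
    have h3 := log_le_log ht0 ht2
    rw [log_mul two_ne_zero (by positivity), log_mul hR0.ne' hw0.ne'] at h3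
    rw [log_pow] at hlog
    push_cast at hlog
    linarith [log_two_lt_d9, log_le_sub_one_of_pos hw0]
  -- The errors add up to `6 + 2 (1 + 9 w⁴ / 8) + 4096 w⁴`, at most `4107 w⁴` since `w ≥ 1`.
  have h3 : t * boseConst - 4107 * w ^ 4 ≤ log (dirichletPartition N β (n + 1)) := by linarith
  refine (freeEnergy_le N hβ (Nat.succ_ne_zero n)).trans ?_
  have hn3 : (0 : ℝ) < (n + 1 : ℕ) := by positivity
  -- The block has `n + 1` sites, while the main term is proportional to `n`. The extra site costs
  -- `boseConst * (R ^ 4)⁻¹ ≤ boseConst * w ^ 4`, hence the summand `boseConst` next to `4107` in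
  -- the constant.
  have h4 : boseConst * ((n + 1 : ℕ) * (R ^ 4)⁻¹)
      * (1 - (4107 + boseConst) / boseConst * (R⁻¹ * w ^ 3)) ≤ t * boseConst - 4107 * w ^ 4 := by
    have e1 : ((n + 1 : ℕ) : ℝ) * (R ^ 4)⁻¹ = t + (R ^ 4)⁻¹ := by
      push_cast
      rw [ht]
      ring
    have e2 : boseConst * (t + (R ^ 4)⁻¹) * (1 - (4107 + boseConst) / boseConst * (R⁻¹ * w ^ 3))
        = boseConst * t + boseConst * (R ^ 4)⁻¹
          - (4107 + boseConst) * ((t + (R ^ 4)⁻¹) * (R⁻¹ * w ^ 3)) := by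
      field_simp
    have e3 : w ^ 4 ≤ (t + (R ^ 4)⁻¹) * (R⁻¹ * w ^ 3) := by
      calc w ^ 4 = (R * w) * (R⁻¹ * w ^ 3) := by field_simp
        _ ≤ (t + (R ^ 4)⁻¹) * (R⁻¹ * w ^ 3) := by
          have : 0 ≤ (R ^ 4)⁻¹ := by positivity
          gcongr
          linarith
    have e4 : boseConst * (R ^ 4)⁻¹ ≤ boseConst * w ^ 4 := by
      have : (R ^ 4)⁻¹ ≤ 1 := inv_le_one_of_one_le₀ (one_le_pow₀ (by linarith))
      gcongr
      linarith
    have e5 := mul_le_mul_of_nonneg_left e3 (show 0 ≤ 4107 + boseConst by linarith)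
    rw [e1, e2]
    linarith
  have h5 := mul_le_mul_of_nonneg_left (h4.trans h3)
    (show 0 ≤ 1 / (β * (n + 1 : ℕ)) by positivity)
  calc _ ≤ -(1 / (β * (n + 1 : ℕ)) * (boseConst * ((n + 1 : ℕ) * (R ^ 4)⁻¹)
      * (1 - (4107 + boseConst) / boseConst * (R⁻¹ * w ^ 3)))) := by
        rw [neg_mul]
        exact neg_le_neg h5
    _ = _ := by
        field_simp

end Asymptotics

end Heisenberg

end

theorem proposition4p1 :
    (∀ (N : ℕ) (β : ℝ), 1 ≤ N → 0 < β →
      Tendsto (fun L : ℕ => Heisenberg.finiteFreeEnergy N L β) atTop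
        (𝓝 (Heisenberg.freeEnergy N β))) ∧
    ∃ C X₀ : ℝ, 0 < C ∧ 1 < X₀ ∧ ∀ (N : ℕ) (β S : ℝ), 1 ≤ N → 0 < β → S = Heisenberg.spin N →
      X₀ ≤ β * S →
      Heisenberg.freeEnergy N β ≤
        Heisenberg.C₁ * S ^ (-(1 / 2) : ℝ) * β ^ (-(3 / 2) : ℝ) *
          (1 - C * ((β * S) ^ (-(1 / 8) : ℝ) * Real.log (β * S) ^ (3 / 4 : ℝ))) := by
  refine ⟨fun N β _ hβ => Heisenberg.tendsto_finiteFreeEnergy N hβ, ?_⟩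
  obtain ⟨X₀, hX₀, h⟩ := Heisenberg.exists_forall_log_rpow_le
  have hD := Heisenberg.boseConst_pos
  refine ⟨(4107 + Heisenberg.boseConst) / Heisenberg.boseConst, X₀, by positivity, hX₀, ?_⟩
  rintro N β S hN hβ rfl hX
  obtain ⟨hl, hX1⟩ := h _ hX
  have hXp : 0 < β * Heisenberg.spin N := by linarith
  have hS : 0 < Heisenberg.spin N := (mul_pos_iff_of_pos_left hβ).1 hXp
  set X := β * Heisenberg.spin N with hXdef
  have hw3 : (Real.log X ^ (1 / 4 : ℝ)) ^ 3 = Real.log X ^ (3 / 4 : ℝ) := by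
    rw [← Real.rpow_mul_natCast (by linarith)]
    norm_num
  have hw4 : (Real.log X ^ (1 / 4 : ℝ)) ^ 4 = Real.log X := by
    rw [← Real.rpow_mul_natCast (by linarith)]
    norm_num
  have hR8 : (X ^ (1 / 8 : ℝ)) ^ 8 = X := by
    rw [← Real.rpow_mul_natCast hXp.le]
    norm_num
  have hR4 : ((X ^ (1 / 8 : ℝ)) ^ 4)⁻¹ = X ^ (-(1 / 2) : ℝ) := by
    rw [← Real.rpow_mul_natCast hXp.le, ← Real.rpow_neg hXp.le]
    norm_num
  have hmain := Heisenberg.freeEnergy_le_of_large (R := X ^ (1 / 8 : ℝ))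
    (w := Real.log X ^ (1 / 4 : ℝ)) hN hβ (Real.one_le_rpow hl (by norm_num))
    (by rw [hw3]; exact hX1) (by rw [hR8]) (by rw [hR8, hw4])
  rw [hw3, hR4, ← Real.rpow_neg hXp.le] at hmain
  -- The prefactor is the temperature divided by the thermal wave length `(β S) ^ (1 / 2)`.
  have hprod : β⁻¹ * X ^ (-(1 / 2) : ℝ)
      = Heisenberg.spin N ^ (-(1 / 2) : ℝ) * β ^ (-(3 / 2) : ℝ) := by
    rw [hXdef, Real.mul_rpow hβ.le hS.le, ← Real.rpow_neg_one, ← mul_assoc,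
      ← Real.rpow_add hβ, mul_comm]
    norm_num
  rw [hprod, ← Heisenberg.C₁_eq, ← mul_assoc] at hmain
  exact hmain
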